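/- **Definitions.** Let $(R,\mathfrak m,\Bbbk)$ be a Noetherian local domain of Krull dimension $d$ with fraction field $\mathbb F$. Fix a vector $\mathbf a\in\mathbb R^d$ for which the map $\mathbb Z^d\to\mathbb R$, $\mathbf u\mapsto\langle\mathbf u,\mathbf a\rangle$, is injective, and order $\mathbb Z^d$ by $\mathbf u\le\mathbf v\iff\langle\mathbf u,\mathbf a\rangle\le\langle\mathbf v,\mathbf a\rangle$. A valuation on $\mathbb F$ with value group $\mathbb Z^d$ is a surjective group homomorphism $\nu:\mathbb F^\times\to\mathbb Z^d$ with $\nu(x+y)\ge\min(\nu(x),\nu(y))$ whenever $x,y,x+y\ne0$. Put $\mathbb F_{\ge\mathbf u}=\{0\}\cup\{x\in\mathbb F^\times:\nu(x)\ge\mathbf u\}$, and let $V=\mathbb F_{\ge\mathbf 0}$ be the valuation ring, with residue field $\Bbbk_V$. The valuation $\nu$ is *OK relative to $R$* if 1. $R\subseteq V$, and this inclusion is a local homomorphism; 2. every nonzero point $\mathbf u$ of the closed convex cone in $\mathbb R^d$ generated by $\nu(R\setminus 0)$ satisfies $\langle\mathbf u,\mathbf a\rangle>0$; 3. the field extension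 $\Bbbk\hookrightarrow\Bbbk_V$ is finite; 4. there is $\mathbf v\in\mathbb Z^d$ such that $R\cap\mathbb F_{\ge n\mathbf v}\subseteq\mathfrak m^n$ for every integer $n\ge0$. The domain $R$ is *OK* if for some such $\mathbf a$ there is a valuation on $\mathbb F$ with value group $\mathbb Z^d$ that is OK relative to $R$. Let $R$ have prime characteristic $p$. For an ideal $I$ and a power $q$ of $p$, let $I^{[q]}$ be the ideal generated by the $q$-th powers of the elements of $I$. A *$p$-family* is a sequence of ideals $I_\bullet=\{I_q\}$ indexed by the powers $q=p^e$, $e\ge0$, of $p$ such that $I_q^{[p]}\subseteq I_{pq}$ for all $q$. If all $I_q$ are $\mathfrak m$-primary, its *volume* is $$\operatorname{vol}_R(I_\bullet)=\lim_{q\to\infty}\frac{\ell_R(R/I_q)}{q^d},$$ where $\ell_R$ denotes length. **Theorem.** Let $(R,\mathfrak m)$ be an OK (Noetherian) local domain of characteristic $p>0$ and dimension $d$, and let $I_\bullet$ be a $p$-family of $\mathfrak m$-primary ideals of $R$. Then the limit $\operatorname{vol}_R(I_\bullet)$ exists and is finite, and $\operatorname{vol}_R(I_\bullet)>0$ if and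 only if there is a power $q_\circ$ of $p$ such that $I_{qq_\circ}\subseteq\mathfrak m^{[q]}$ for all powers $q$ of $p$. -/

import Mathlib

open Filter Topology

noncomputable section

namespace OKDomain

/-- The `ℤ`-linear map `ℤ^d → ℝ`, `u ↦ ⟨u, a⟩`, induced by a vector `a ∈ ℝ^d`. -/
def latticeMap {d : ℕ} (a : Fin d → ℝ) : (Fin d → ℤ) →+ ℝ where
  toFun u := (fun i => (u i : ℝ)) ⬝ᵥ a
  map_zero' := by simp [dotProduct]
  map_add' u v := by simp [dotProduct, add_mul, Finset.sum_add_distrib]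

/-- A valuation on the field `F` with value group `ℤ^d`, where `ℤ^d` is linearly ordered through
the `ℤ`-linear embedding `u ↦ ⟨u, a⟩` into `ℝ` (so `u ≤ v` means `⟨u, a⟩ ≤ ⟨v, a⟩`). -/
structure LatticeValuation (F : Type*) [Field F] {d : ℕ} (a : Fin d → ℝ) where
  /-- the homomorphism `ν : Fˣ → ℤ^d` -/
  hom : Fˣ →* Multiplicative (Fin d → ℤ)
  embedding : Function.Injective (latticeMap a)
  surjective : Function.Surjective hom
  min_le_add : ∀ x y z : Fˣ, (x : F) + y = z →
    min (latticeMap a (hom x).toAdd) (latticeMap a (hom y).toAdd) ≤ latticeMap a (hom z).toAdd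

namespace LatticeValuation

variable {F : Type*} [Field F] {d : ℕ} {a : Fin d → ℝ} (ν : LatticeValuation F a)

/-- The value `ν x ∈ ℤ^d` of a unit `x` of `F`. -/
def val (x : Fˣ) : Fin d → ℤ := (ν.hom x).toAdd

/-- The set `F_{≥ u}` of all `x ∈ F` with `x = 0` or `ν x ≥ u`. -/
def geq (u : Fin d → ℤ) : Set F :=
  {x | ∀ y : Fˣ, (y : F) = x → latticeMap a u ≤ latticeMap a (ν.val y)}

/-- The valuation ring `V = F_{≥ 0}` of `ν`. -/
def ring : ValuationSubring F where
  carrier := ν.geq 0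
  zero_mem' := fun y hy => absurd hy y.ne_zero
  one_mem' := fun y hy => by
    have : y = 1 := Units.ext hy
    simp [this, val]
  mul_mem' := by
    intro x y hx hy z hz
    have hxy : x * y ≠ 0 := hz ▸ z.ne_zero
    have h0 : x ≠ 0 := left_ne_zero_of_mul hxy
    have h1 : y ≠ 0 := right_ne_zero_of_mul hxy
    have hz' : z = Units.mk0 x h0 * Units.mk0 y h1 := Units.ext (by simpa using hz)
    have hx' := hx (Units.mk0 x h0) rfl
    have hy' := hy (Units.mk0 y h1) rfl
    simp only [map_zero, val, hz', map_mul, toAdd_mul, map_add] at *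
    exact add_nonneg hx' hy'
  add_mem' := by
    intro x y hx hy z hz
    by_cases h0 : x = 0
    · exact hy z (by simpa [h0] using hz)
    by_cases h1 : y = 0
    · exact hx z (by simpa [h1] using hz)
    exact (le_min (hx (Units.mk0 x h0) rfl) (hy (Units.mk0 y h1) rfl)).trans
      (ν.min_le_add (Units.mk0 x h0) (Units.mk0 y h1) z (by simpa using hz.symm))
  neg_mem' := by
    intro x hx y hy
    have hx' := hx (-y) (by simp [hy])
    have h1 : latticeMap a (ν.val (-1)) = 0 := by
      have h : ν.val (-1) + ν.val (-1) = 0 := by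
        simp only [val, ← toAdd_mul, ← map_mul]; simp
      have := congrArg (latticeMap a) h
      rw [map_add, map_zero] at this
      linarith
    have h2 : ν.val (-y) = ν.val (-1) + ν.val y := by
      simp only [val, ← toAdd_mul, ← map_mul]; simp
    rw [h2, map_add, h1, zero_add] at hx'
    exact hx'
  mem_or_inv_mem' := by
    intro x
    by_cases h0 : x = 0
    · left; intro y hy; exact absurd (hy.trans h0) y.ne_zero
    rcases le_total 0 (latticeMap a (ν.val (Units.mk0 x h0))) with h | h
    · left; intro y hy
      have : y = Units.mk0 x h0 := Units.ext hy
      simpa [this] using h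
    · right; intro y hy
      have : y = (Units.mk0 x h0)⁻¹ := Units.ext (by simpa using hy)
      simp only [this, val, map_inv, toAdd_inv, map_neg, map_zero] at *
      linarith

variable (D : Type*) [CommRing D] [Algebra D F]

/-- The set `ν(D) = ν(D \ 0)`, viewed in `ℝ^d`. -/
def semigroup : Set (Fin d → ℝ) :=
  {w | ∃ (x : D) (y : Fˣ), (y : F) = algebraMap D F x ∧ w = fun i => (ν.val y i : ℝ)}

/-- The closed cone in `ℝ^d` generated by `ν(D)`: the closure of the set of all linear
combinations of points of `ν(D)` with nonnegative real coefficients. -/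
def closedCone : Set (Fin d → ℝ) :=
  closure (PointedCone.hull ℝ (ν.semigroup D) : Set (Fin d → ℝ))

/-- The valuation `ν` is OK relative to the local domain `D` with fraction field `F`. -/
structure IsOK [IsLocalRing D] : Prop where
  /-- `D` is contained in the valuation ring `V`. -/
  le_ring : ∀ x : D, algebraMap D F x ∈ ν.ring.toSubring
  /-- The inclusion `D → V` is local, so that `D` is dominated by `ν`. -/
  isLocalHom : IsLocalHom ((algebraMap D F).codRestrict ν.ring.toSubring le_ring)
  /-- The closed cone generated by `ν(D)` is pointed by the order on `ℤ^d`; with the domination of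
  `D` by `ν` this says that `D` is strongly dominated by `ν`. -/
  pointed : ∀ w ∈ ν.closedCone D, w ≠ 0 → 0 < w ⬝ᵥ a
  /-- The extension of residue fields is finite. -/
  finite_residue : (IsLocalRing.ResidueField.map
    (S := ν.ring) ((algebraMap D F).codRestrict ν.ring.toSubring le_ring)).Finite
  /-- There is `v ∈ ℤ^d` with `D ∩ F_{≥ n v} ⊆ 𝔪 ^ n` for every nonnegative integer `n`. -/
  exists_vector : ∃ v : Fin d → ℤ, ∀ (n : ℕ) (x : D),
    algebraMap D F x ∈ ν.geq (n • v) → x ∈ IsLocalRing.maximalIdeal D ^ n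

end LatticeValuation

/-- A local domain `D` of dimension `d` is OK if there is a valuation on its fraction field, with
value group `ℤ^d` (for some embedding of `ℤ^d` into `ℝ`), that is OK relative to `D`. -/
def IsOKDomain (D : Type*) [CommRing D] [IsDomain D] [IsLocalRing D] : Prop :=
  ∃ d : ℕ, ringKrullDim D = d ∧ ∃ (a : Fin d → ℝ) (ν : LatticeValuation (FractionRing D) a),
    ν.IsOK D

/-- The Frobenius power `I^{[q]}`: the ideal generated by the `q`-th powers of elements of `I`. -/
def frobeniusPow {R : Type*} [CommRing R] (I : Ideal R) (q : ℕ) : Ideal R :=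
  Ideal.span ((fun x => x ^ q) '' (I : Set R))

/-- A sequence of ideals indexed by the powers of `p`, where `I e` is the term with index
`q = p ^ e`, is a `p`-family if `I_q^{[p]} ⊆ I_{pq}` for every power `q` of `p`. -/
def IsPFamily {R : Type*} [CommRing R] (p : ℕ) (I : ℕ → Ideal R) : Prop :=
  ∀ e : ℕ, frobeniusPow (I e) p ≤ I (e + 1)

/-- An ideal of a local ring `(R, 𝔪)` is `𝔪`-primary. -/
def IsMaxPrimary {R : Type*} [CommRing R] [IsLocalRing R] (I : Ideal R) : Prop :=
  I.IsPrimary ∧ I.radical = IsLocalRing.maximalIdeal R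

/-- `L` is the limit of `ℓ_R(R / I_q) / q ^ d` as `q = p ^ e → ∞`.
(The lengths are finite when `R` is Noetherian and the ideals are `𝔪`-primary.) -/
def HasVolume {R : Type*} [CommRing R] (p d : ℕ) (I : ℕ → Ideal R) (L : ℝ) : Prop :=
  Tendsto (fun e : ℕ => ((Module.length R (R ⧸ I e)).toNat : ℝ) / ((p : ℝ) ^ e) ^ d)
    atTop (𝓝 L)

end OKDomain

end

/-! Lengths are reduced to counting lattice points. Let S = ν(R), T_q = ν(I_q) and δ = [k_V : k].
Filter R by value: each graded piece of R/J embeds in a quotient of the residue field or vanishes,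
and a common denominator b of representatives of k_V shows that ℓ(R/J) equals δ·#(S \ ν(J)) up to δ
times the number of u ∈ S, below a height bound, with u - ν(b) ∉ S (`exists_length_bounds`).

All error terms are counted by one set, `gap`: lattice points outside S, of height O(q), within o(q)
of the cone of S. There are o(q^d) of them (`tendsto_ncard_gap`), since S contains the rounded
multiples of any interior point of its cone and the frontier of a convex set is null.

Dividing lattice points by p^k with remainder, and using p·T_q ⊆ T_{pq}, shows that #(S \ T_q)/q^d
is decreasing in q up to an error tending to 0, so it converges (`IsPSystem.exists_tendsto`).

For positivity, the limit L of these counts is positive exactly when the heights in T_q are at least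
εq for some ε > 0. A point of T_q of relatively tiny height has multiples whose translates of S fill
almost all of S, which forces L = 0 (`exists_le_of_pos`); conversely S has at least a constant times
q^d points of height below εq (`pos_of_eventually_le`). Linear comparisons between powers of 𝔪,
Frobenius powers and the ideals R_{≥t} translate the height bound into the containment in 𝔪^{[q]}.
-/

noncomputable section

namespace OKDomain

open MeasureTheory

/-! ### Lattice points near the cone of a semigroup -/

section Lattice

variable {d : ℕ}

/-- The inclusion of `ℤ^d` into `ℝ^d`. -/
def realVec : (Fin d → ℤ) →+ (Fin d → ℝ) where
  toFun u i := u i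
  map_zero' := by ext; simp
  map_add' u v := by ext; simp

@[simp] lemma realVec_apply (u : Fin d → ℤ) (i : Fin d) : realVec u i = u i := rfl

lemma latticeMap_eq (a : Fin d → ℝ) (u : Fin d → ℤ) : latticeMap a u = realVec u ⬝ᵥ a := rfl

/-- The cone in `ℝ^d` spanned by a subset of `ℤ^d`. -/
def realCone (S : Set (Fin d → ℤ)) : PointedCone ℝ (Fin d → ℝ) := PointedCone.hull ℝ (realVec '' S)

lemma realVec_mem_realCone {S : Set (Fin d → ℤ)} {u : Fin d → ℤ} (hu : u ∈ S) :
    realVec u ∈ realCone S :=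
  Submodule.subset_span ⟨u, hu, rfl⟩

/-- Write the basis vectors as s_i - t_i and take g = ∑ (s_i + t_i). Then b + c g = ∑ ((c + b_i) s_i
+ (c - b_i) t_i), with nonnegative coefficients once |b_i| ≤ c. -/
lemma exists_add_nsmul_mem {S : AddSubmonoid (Fin d → ℤ)}
    (hS : ∀ u : Fin d → ℤ, ∃ s ∈ S, ∃ t ∈ S, u = s - t) :
    ∃ g ∈ S, ∀ (b : Fin d → ℤ) (c : ℕ), (∀ i, |b i| ≤ c) → b + c • g ∈ S := by
  choose s hs t ht hst using fun i : Fin d => hS (Pi.single i 1)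
  refine ⟨∑ i, (s i + t i), sum_mem fun i _ => add_mem (hs i) (ht i), fun b c hb => ?_⟩
  have h : b + c • ∑ i, (s i + t i) =
      ∑ i, ((b i + c).toNat • s i + (c - b i).toNat • t i) := by
    have hb' : b = ∑ i, b i • (s i - t i) := by
      ext j
      simp [← hst, Pi.single_apply]
    conv_lhs => rw [hb', Finset.smul_sum, ← Finset.sum_add_distrib]
    refine Finset.sum_congr rfl fun i _ => ?_
    have := abs_le.1 (hb i)
    rw [← natCast_zsmul, ← natCast_zsmul, ← natCast_zsmul, Int.toNat_of_nonneg (by linarith),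
      Int.toNat_of_nonneg (by linarith)]
    module
  rw [h]
  exact sum_mem fun i _ => add_mem (nsmul_mem (hs i) _) (nsmul_mem (ht i) _)

/-- Rounding the multiple of each generator costs a bounded error. The parameter n is real so that a
scalar c can be absorbed by passing from n to n c. -/
lemma exists_approx_of_mem_realCone {S : AddSubmonoid (Fin d → ℤ)} {y : Fin d → ℝ}
    (hy : y ∈ realCone (S : Set (Fin d → ℤ))) :
    ∃ K : ℝ, ∀ n : ℝ, 0 ≤ n → ∃ s ∈ S, ‖n • y - realVec s‖ ≤ K := by
  induction hy using Submodule.span_induction with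
  | mem x hx =>
    obtain ⟨s, hs, rfl⟩ := hx
    refine ⟨‖realVec s‖, fun n hn => ⟨⌊n⌋₊ • s, nsmul_mem hs _, ?_⟩⟩
    rw [map_nsmul, ← Nat.cast_smul_eq_nsmul ℝ, ← sub_smul, norm_smul]
    refine mul_le_of_le_one_left (norm_nonneg _) ?_
    rw [Real.norm_eq_abs, abs_le]
    constructor <;> linarith [Nat.floor_le hn, Nat.lt_floor_add_one n]
  | zero => exact ⟨0, fun n _ => ⟨0, zero_mem _, by simp⟩⟩
  | add x y _ _ hx hy =>
    obtain ⟨K, hK⟩ := hx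
    obtain ⟨L, hL⟩ := hy
    refine ⟨K + L, fun n hn => ?_⟩
    obtain ⟨s, hs, hs'⟩ := hK n hn
    obtain ⟨t, ht, ht'⟩ := hL n hn
    refine ⟨s + t, add_mem hs ht, ?_⟩
    rw [smul_add, map_add, add_sub_add_comm]
    exact (norm_add_le _ _).trans (add_le_add hs' ht')
  | smul c x _ hx =>
    obtain ⟨K, hK⟩ := hx
    refine ⟨K, fun n hn => ?_⟩
    obtain ⟨s, hs, hs'⟩ := hK (n * c) (mul_nonneg hn c.2)
    exact ⟨s, hs, by simpa [mul_smul] using hs'⟩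

lemma norm_le_of_forall_floor {x : Fin d → ℝ} :
    ‖realVec (fun i => ⌊x i⌋) - x‖ ≤ 1 := by
  refine (pi_norm_le_iff_of_nonneg zero_le_one).2 fun i => ?_
  rw [Real.norm_eq_abs, abs_le, Pi.sub_apply, realVec_apply]
  constructor <;> linarith [Int.floor_le (x i), Int.lt_floor_add_one (x i)]

/-- For small ε the point x - ε g still lies in the cone, so its n-th multiple is near some s ∈ S.
What remains of the rounded n x is ⌊n ε⌋ g plus a bounded vector, which that many copies of g absorb
for large n. -/
lemma eventually_floor_mem {S : AddSubmonoid (Fin d → ℤ)}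
    (hS : ∀ u : Fin d → ℤ, ∃ s ∈ S, ∃ t ∈ S, u = s - t) {x : Fin d → ℝ}
    (hx : x ∈ interior (realCone (S : Set (Fin d → ℤ)) : Set (Fin d → ℝ))) :
    ∀ᶠ n : ℝ in atTop, (fun i => ⌊n * x i⌋) ∈ S := by
  obtain ⟨g, hg, hgS⟩ := exists_add_nsmul_mem hS
  obtain ⟨ε, hε, hεx⟩ : ∃ ε : ℝ, 0 < ε ∧ x - ε • realVec g ∈ realCone (S : Set (Fin d → ℤ)) := by
    have h : Tendsto (fun ε : ℝ => x - ε • realVec g) (𝓝[>] 0) (𝓝 x) := by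
      have : Continuous (fun ε : ℝ => x - ε • realVec g) := by fun_prop
      have h0 := this.tendsto 0
      simp only [zero_smul, sub_zero] at h0
      exact h0.mono_left nhdsWithin_le_nhds
    have h1 := (h.eventually (mem_interior_iff_mem_nhds.1 hx)).and self_mem_nhdsWithin
    obtain ⟨ε, h2, h3⟩ := h1.exists
    exact ⟨ε, h3, h2⟩
  obtain ⟨K, hK⟩ := exists_approx_of_mem_realCone hεx
  -- The summands bound the errors from rounding n x, from approximating by s, and from rounding n
  -- ε.
  set c : ℝ := 1 + K + ‖realVec g‖ with hc
  filter_upwards [eventually_ge_atTop ((⌈c⌉₊ + 1) / ε), eventually_ge_atTop 0] with n hn hn0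
  obtain ⟨s, hs, hs'⟩ := hK n hn0
  set v : Fin d → ℤ := fun i => ⌊n * x i⌋ with hv
  set b : Fin d → ℤ := v - s - ⌊n * ε⌋₊ • g with hb
  have hnε : 0 ≤ n * ε := by positivity
  have hbn : ‖realVec b‖ ≤ c := by
    have h1 : realVec b = (realVec v - n • x) + (n • (x - ε • realVec g) - realVec s) +
        (n * ε - ⌊n * ε⌋₊) • realVec g := by
      rw [hb, map_sub, map_sub, map_nsmul, ← Nat.cast_smul_eq_nsmul ℝ]
      module
    rw [h1]
    refine (norm_add₃_le).trans (add_le_add (add_le_add ?_ hs') ?_)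
    · exact norm_le_of_forall_floor (x := n • x)
    · rw [norm_smul]
      refine mul_le_of_le_one_left (norm_nonneg _) ?_
      rw [Real.norm_eq_abs, abs_le]
      constructor <;> linarith [Nat.floor_le hnε, Nat.lt_floor_add_one (n * ε)]
  have hcn : ⌈c⌉₊ ≤ ⌊n * ε⌋₊ := by
    refine Nat.le_floor ?_
    rw [div_le_iff₀ hε] at hn
    linarith
  have hmem : b + ⌊n * ε⌋₊ • g ∈ S := by
    refine hgS b _ fun i => ?_
    have h2 : ‖realVec b i‖ ≤ c := (norm_le_pi_norm _ i).trans hbn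
    rw [realVec_apply, Real.norm_eq_abs] at h2
    have h3 : |(b i : ℝ)| ≤ (⌊n * ε⌋₊ : ℝ) :=
      h2.trans ((Nat.le_ceil c).trans (by exact_mod_cast hcn))
    exact_mod_cast h3
  have : v = (b + ⌊n * ε⌋₊ • g) + s := by rw [hb]; abel
  rw [this]
  exact add_mem hmem hs

/-- The union of the half-open cubes of side `1 / n` with lower corners the points of `A / n`. -/
def cubes (A : Finset (Fin d → ℤ)) (n : ℝ) : Set (Fin d → ℝ) :=
  {x | (fun i => ⌊n * x i⌋) ∈ A}

lemma cubes_eq (A : Finset (Fin d → ℤ)) {n : ℝ} (hn : 0 < n) :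
    cubes A n = ⋃ v ∈ A, Set.pi Set.univ fun i => Set.Ico ((v i : ℝ) / n) ((v i + 1) / n) := by
  ext x
  simp only [cubes, Set.mem_ofPred_eq, Set.mem_iUnion, Set.mem_pi, Set.mem_univ, true_imp_iff,
    exists_prop, Set.mem_Ico, div_le_iff₀ hn, lt_div_iff₀ hn]
  constructor
  · intro h
    refine ⟨_, h, fun i => ?_⟩
    rw [mul_comm (x i)]
    exact ⟨Int.floor_le _, Int.lt_floor_add_one _⟩
  · rintro ⟨v, hv, h⟩
    convert hv using 1
    ext i
    rw [mul_comm, Int.floor_eq_iff]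
    exact h i

lemma measurableSet_cubes (A : Finset (Fin d → ℤ)) {n : ℝ} (hn : 0 < n) :
    MeasurableSet (cubes A n) := by
  rw [cubes_eq A hn]
  exact Finset.measurableSet_biUnion _ fun v _ =>
    MeasurableSet.univ_pi fun i => measurableSet_Ico

lemma volume_cubes (A : Finset (Fin d → ℤ)) {n : ℝ} (hn : 0 < n) :
    volume (cubes A n) = ENNReal.ofReal (A.card / n ^ d) := by
  rw [cubes_eq A hn, measure_biUnion_finset]
  · have : ∀ v ∈ A, volume (Set.pi Set.univ fun i => Set.Ico ((v i : ℝ) / n) ((v i + 1) / n))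
        = ENNReal.ofReal ((n ^ d)⁻¹) := by
      intro v _
      rw [Real.volume_pi_Ico]
      simp only [add_div, add_sub_cancel_left, Finset.prod_const, Finset.card_univ,
        Fintype.card_fin]
      rw [← ENNReal.ofReal_pow (by positivity)]
      simp
    rw [Finset.sum_congr rfl this, Finset.sum_const, nsmul_eq_mul, div_eq_mul_inv,
      ENNReal.ofReal_mul (by positivity), ENNReal.ofReal_natCast]
  · intro v _ w _ hvw
    rw [Function.onFun, Set.disjoint_left]
    intro x hx hx'
    apply hvw
    ext i
    have h1 := hx i trivial
    have h2 := hx' i trivial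
    simp only [Set.mem_Ico, div_le_iff₀ hn, lt_div_iff₀ hn] at h1 h2
    rw [← Int.floor_eq_iff] at h1 h2
    rw [← h1, ← h2]
  · intro v _
    exact MeasurableSet.univ_pi fun i => measurableSet_Ico

/-- Lattice points close to the cone of a semigroup that generates the lattice lie in the
semigroup, up to a set of density zero. -/
theorem tendsto_card_div_pow_zero {S : AddSubmonoid (Fin d → ℤ)}
    (hS : ∀ u : Fin d → ℤ, ∃ s ∈ S, ∃ t ∈ S, u = s - t) {n ρ : ℕ → ℝ} {M : ℝ}
    {A : ℕ → Finset (Fin d → ℤ)} (hn : Tendsto n atTop atTop) (hn0 : ∀ j, 0 < n j)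
    (hρ : Tendsto (fun j => ρ j / n j) atTop (𝓝 0))
    (hAS : ∀ j, ∀ v ∈ A j, v ∉ S) (hAM : ∀ j, ∀ v ∈ A j, ‖realVec v‖ ≤ M * n j)
    (hAρ : ∀ j, ∀ v ∈ A j, ∃ z : Fin d → ℝ, ‖z‖ ≤ ρ j ∧
      realVec v + z ∈ realCone (S : Set (Fin d → ℤ))) :
    Tendsto (fun j => ((A j).card : ℝ) / n j ^ d) atTop (𝓝 0) := by
  set C : PointedCone ℝ (Fin d → ℝ) := realCone (S : Set (Fin d → ℤ)) with hC
  set H : Set (Fin d → ℝ) := (C : Set (Fin d → ℝ)) with hH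
  have hconv : Convex ℝ H := PointedCone.convex _
  -- An interior point leaves the cubes because its rounded multiples enter S. A point off the
  -- closure leaves them because every point of a cube is within (1 + ρ)/n of the cone. The frontier
  -- is null.
  have key : ∀ᵐ x : Fin d → ℝ ∂volume, ∀ᶠ j in atTop, x ∉ cubes (A j) (n j) := by
    have h0 : ∀ᵐ x : Fin d → ℝ ∂volume, x ∉ frontier H :=
      measure_eq_zero_iff_ae_notMem.1 (hconv.addHaar_frontier volume)
    filter_upwards [h0] with x hx
    by_cases hi : x ∈ interior H
    · filter_upwards [hn.eventually (eventually_floor_mem hS hi)] with j hj h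
      exact hAS j _ h hj
    · have hcl : x ∉ closure H := fun h => hx ⟨h, hi⟩
      obtain ⟨ε, hε, hεx⟩ := Metric.isOpen_iff.1 isClosed_closure.isOpen_compl x hcl
      have h1 : Tendsto (fun j => 1 / n j + ρ j / n j) atTop (𝓝 0) := by
        simpa using ((tendsto_const_nhds (x := (1 : ℝ))).div_atTop hn).add hρ
      filter_upwards [h1.eventually (gt_mem_nhds hε)] with j hj h
      obtain ⟨z, hz, hzH⟩ := hAρ j _ h
      set v : Fin d → ℤ := fun i => ⌊n j * x i⌋ with hv
      have hy : (n j)⁻¹ • (realVec v + z) ∈ H :=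
        C.smul_mem (inv_nonneg.2 (hn0 j).le) hzH
      refine hεx ?_ (subset_closure hy)
      rw [Metric.mem_ball, dist_eq_norm]
      have h2 : (n j)⁻¹ • (realVec v + z) - x = (n j)⁻¹ • ((realVec v - n j • x) + z) := by
        rw [smul_add, smul_add, smul_sub, smul_smul, inv_mul_cancel₀ (hn0 j).ne', one_smul]
        abel
      rw [h2, norm_smul, norm_inv, Real.norm_of_nonneg (hn0 j).le]
      refine lt_of_le_of_lt ?_ hj
      rw [← add_div, div_eq_inv_mul]
      refine mul_le_mul_of_nonneg_left ?_ (inv_nonneg.2 (hn0 j).le)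
      refine (norm_add_le _ _).trans (add_le_add ?_ hz)
      exact norm_le_of_forall_floor (x := n j • x)
  have hsub : ∀ᶠ j in atTop, cubes (A j) (n j) ⊆ Metric.closedBall 0 (M + 1) := by
    filter_upwards [hn.eventually (eventually_ge_atTop 1)] with j hj x hx
    rw [mem_closedBall_zero_iff]
    have h1 := hAM j _ hx
    have h2 : ‖n j • x‖ ≤ M * n j + 1 := by
      have h3 := norm_le_of_forall_floor (x := n j • x)
      have h4 := norm_sub_norm_le (n j • x) (realVec fun i => ⌊n j * x i⌋)
      rw [norm_sub_rev] at h4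
      exact (sub_le_iff_le_add.1 h4).trans ((add_le_add h3 h1).trans (add_comm _ _).le)
    rw [norm_smul, Real.norm_of_nonneg (hn0 j).le] at h2
    nlinarith [hn0 j]
  -- Dominated convergence inside a fixed ball; the volumes are the normalized cardinalities.
  have h := tendsto_measure_of_ae_tendsto_indicator atTop (μ := (volume : Measure (Fin d → ℝ)))
    (A := ∅) (As := fun j => cubes (A j) (n j)) MeasurableSet.empty
    (fun j => measurableSet_cubes (A j) (hn0 j)) (B := Metric.closedBall 0 (M + 1))
    Metric.isClosed_closedBall.measurableSet measure_closedBall_lt_top.ne hsub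
    (by simpa using key)
  simp only [volume_cubes _ (hn0 _), measure_empty] at h
  have h2 := (ENNReal.tendsto_toReal ENNReal.zero_ne_top).comp h
  refine h2.congr fun j => ?_
  simp only [Function.comp]
  exact ENNReal.toReal_ofReal (div_nonneg (Nat.cast_nonneg _) (pow_nonneg (hn0 j).le _))

lemma finite_setOf_norm_realVec_le (C : ℝ) : {v : Fin d → ℤ | ‖realVec v‖ ≤ C}.Finite := by
  refine (Set.finite_Icc (fun _ => -⌈C⌉) (fun _ => ⌈C⌉)).subset fun v hv => ?_
  have h : ∀ i, |v i| ≤ ⌈C⌉ := fun i => by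
    have h1 : |(v i : ℝ)| ≤ C := by
      have := (norm_le_pi_norm (realVec v) i).trans hv
      simpa using this
    have h2 : |(v i : ℝ)| ≤ (⌈C⌉ : ℝ) := h1.trans (Int.le_ceil C)
    exact_mod_cast h2
  exact ⟨fun i => (abs_le.1 (h i)).1, fun i => (abs_le.1 (h i)).2⟩

/-- The lattice points outside `S`, of height less than `h`, at distance at most `ρ` from the
cone spanned by `S`. -/
def gap (S : AddSubmonoid (Fin d → ℤ)) (a : Fin d → ℝ) (h ρ : ℝ) : Set (Fin d → ℤ) :=
  {v | v ∉ S ∧ latticeMap a v < h ∧ ∃ z : Fin d → ℝ, ‖z‖ ≤ ρ ∧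
    realVec v + z ∈ realCone (S : Set (Fin d → ℤ))}

lemma abs_dotProduct_le (w a : Fin d → ℝ) : |w ⬝ᵥ a| ≤ (∑ i, |a i|) * ‖w‖ := by
  rw [dotProduct, Finset.sum_mul]
  refine (Finset.abs_sum_le_sum_abs _ _).trans (Finset.sum_le_sum fun i _ => ?_)
  rw [abs_mul, mul_comm]
  exact mul_le_mul_of_nonneg_left (norm_le_pi_norm w i) (abs_nonneg _)

/-- On the cone, height controls norm; moving by at most ρ changes the height by at most (∑ |a_i|)
ρ. -/
lemma norm_le_of_mem_gap {S : AddSubmonoid (Fin d → ℤ)} {a : Fin d → ℝ} {κ : ℝ} (hκ : 0 < κ)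
    (hp : ∀ w ∈ realCone (S : Set (Fin d → ℤ)), κ * ‖w‖ ≤ w ⬝ᵥ a) {h ρ : ℝ} {v : Fin d → ℤ}
    (hv : v ∈ gap S a h ρ) : ‖realVec v‖ ≤ (h + (∑ i, |a i|) * ρ) / κ + ρ := by
  obtain ⟨-, hvh, z, hz, hvz⟩ := hv
  have h1 := hp _ hvz
  rw [add_dotProduct, ← latticeMap_eq] at h1
  have h2 := (le_abs_self _).trans (abs_dotProduct_le z a)
  have h3 : (∑ i, |a i|) * ‖z‖ ≤ (∑ i, |a i|) * ρ :=
    mul_le_mul_of_nonneg_left hz (Finset.sum_nonneg fun i _ => abs_nonneg _)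
  have h4 : ‖realVec v + z‖ ≤ (h + (∑ i, |a i|) * ρ) / κ := by
    rw [le_div_iff₀ hκ, mul_comm]
    linarith
  have h5 := norm_sub_le (realVec v + z) z
  rw [add_sub_cancel_right] at h5
  linarith

lemma finite_gap {S : AddSubmonoid (Fin d → ℤ)} {a : Fin d → ℝ} {κ : ℝ} (hκ : 0 < κ)
    (hp : ∀ w ∈ realCone (S : Set (Fin d → ℤ)), κ * ‖w‖ ≤ w ⬝ᵥ a) (h ρ : ℝ) :
    (gap S a h ρ).Finite :=
  (finite_setOf_norm_realVec_le _).subset fun _ hv => norm_le_of_mem_gap hκ hp hv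

theorem tendsto_ncard_gap {S : AddSubmonoid (Fin d → ℤ)}
    (hS : ∀ u : Fin d → ℤ, ∃ s ∈ S, ∃ t ∈ S, u = s - t) {a : Fin d → ℝ} {κ : ℝ} (hκ : 0 < κ)
    (hp : ∀ w ∈ realCone (S : Set (Fin d → ℤ)), κ * ‖w‖ ≤ w ⬝ᵥ a) (M : ℝ) {n ρ : ℕ → ℝ}
    (hn : Tendsto n atTop atTop) (hn0 : ∀ j, 0 < n j)
    (hρ : Tendsto (fun j => ρ j / n j) atTop (𝓝 0)) :
    Tendsto (fun j => ((gap S a (M * n j) (ρ j)).ncard : ℝ) / n j ^ d) atTop (𝓝 0) := by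
  obtain ⟨B, hB⟩ := hρ.bddAbove_range
  have hB' : ∀ j, ρ j ≤ B * n j := fun j => (div_le_iff₀ (hn0 j)).1 (hB ⟨j, rfl⟩)
  have ha : 0 ≤ ∑ i, |a i| := Finset.sum_nonneg fun i _ => abs_nonneg _
  refine (tendsto_card_div_pow_zero hS (n := n) (ρ := ρ)
    (M := (M + (∑ i, |a i|) * B) / κ + B)
    (A := fun j => (finite_gap hκ hp (M * n j) (ρ j)).toFinset) hn hn0 hρ ?_ ?_ ?_).congr ?_
  · intro j v hv
    exact ((Set.Finite.mem_toFinset _).1 hv).1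
  · intro j v hv
    refine (norm_le_of_mem_gap hκ hp ((Set.Finite.mem_toFinset _).1 hv)).trans ?_
    have h1 := hB' j
    have h2 := mul_le_mul_of_nonneg_left h1 ha
    have h3 : (M * n j + (∑ i, |a i|) * ρ j) / κ ≤ (M + (∑ i, |a i|) * B) / κ * n j := by
      rw [div_mul_eq_mul_div]
      refine div_le_div_of_nonneg_right ?_ hκ.le
      linarith
    linarith
  · intro j v hv
    exact ((Set.Finite.mem_toFinset _).1 hv).2.2
  · intro j
    rw [Set.ncard_eq_toFinset_card _ (finite_gap hκ hp (M * n j) (ρ j))]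

/-- The limit is the infimum of b e + ε e: an index where this is nearly attained bounds all later
terms. -/
lemma exists_tendsto_of_le_add {b ε : ℕ → ℝ} (hb : ∀ e, 0 ≤ b e)
    (hε : Tendsto ε atTop (𝓝 0)) (h : ∀ e k, b (e + k) ≤ b e + ε e) :
    ∃ L, Tendsto b atTop (𝓝 L) := by
  have hbdd : BddBelow (Set.range fun e => b e + ε e) := by
    refine ⟨0, ?_⟩
    rintro _ ⟨e, rfl⟩
    exact (hb (e + 0)).trans (h e 0)
  refine ⟨⨅ e, (b e + ε e), tendsto_order.2 ⟨fun x hx => ?_, fun x hx => ?_⟩⟩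
  · filter_upwards [hε.eventually (gt_mem_nhds (sub_pos.2 hx))] with e he
    have := ciInf_le hbdd e
    linarith
  · obtain ⟨e, he⟩ := exists_lt_of_ciInf_lt hx
    filter_upwards [eventually_ge_atTop e] with m hm
    obtain ⟨k, rfl⟩ := Nat.exists_eq_add_of_le hm
    exact (h e k).trans_lt he

/-! ### Asymptotic counting for p-systems -/

/-- A `p`-system in a semigroup `S ⊆ ℤ^d` that generates `ℤ^d` and spans a cone on which the
height function given by `a` is positive, with the truncation property of the `p`-systems that come
from `𝔪`-primary ideals. -/
structure IsPSystem (p : ℕ) (a : Fin d → ℝ) (S : AddSubmonoid (Fin d → ℤ)) (κ M : ℝ)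
    (T : ℕ → Set (Fin d → ℤ)) : Prop where
  exists_sub : ∀ u : Fin d → ℤ, ∃ s ∈ S, ∃ t ∈ S, u = s - t
  pos : 0 < κ
  pointed : ∀ w ∈ realCone (S : Set (Fin d → ℤ)), κ * ‖w‖ ≤ w ⬝ᵥ a
  subset : ∀ e, ∀ u ∈ T e, u ∈ S
  add_mem : ∀ e, ∀ u ∈ T e, ∀ s ∈ S, u + s ∈ T e
  nsmul_mem : ∀ e, ∀ u ∈ T e, p • u ∈ T (e + 1)
  mem_of_le : ∀ e, ∀ u ∈ S, M * (p : ℝ) ^ e ≤ latticeMap a u → u ∈ T e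

namespace IsPSystem

variable {p : ℕ} {a : Fin d → ℝ} {S : AddSubmonoid (Fin d → ℤ)} {κ M : ℝ}
  {T : ℕ → Set (Fin d → ℤ)}

lemma norm_le (h : IsPSystem p a S κ M T) {u : Fin d → ℤ} (hu : u ∈ S) :
    κ * ‖realVec u‖ ≤ latticeMap a u :=
  h.pointed _ (realVec_mem_realCone hu)

lemma nonneg (h : IsPSystem p a S κ M T) {u : Fin d → ℤ} (hu : u ∈ S) : 0 ≤ latticeMap a u :=
  (mul_nonneg h.pos.le (norm_nonneg _)).trans (h.norm_le hu)

lemma finite_lt (h : IsPSystem p a S κ M T) (t : ℝ) : {u | u ∈ S ∧ latticeMap a u < t}.Finite := by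
  refine (finite_setOf_norm_realVec_le (t / κ)).subset fun u hu => ?_
  rw [Set.mem_ofPred_eq, le_div_iff₀ h.pos, mul_comm]
  exact (h.norm_le hu.1).trans hu.2.le

lemma lt_of_mem_diff (h : IsPSystem p a S κ M T) {e : ℕ} {u : Fin d → ℤ}
    (hu : u ∈ (S : Set (Fin d → ℤ)) \ T e) : latticeMap a u < M * (p : ℝ) ^ e :=
  lt_of_not_ge fun hle => hu.2 (h.mem_of_le e u hu.1 hle)

lemma finite_diff (h : IsPSystem p a S κ M T) (e : ℕ) : ((S : Set (Fin d → ℤ)) \ T e).Finite :=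
  (h.finite_lt (M * (p : ℝ) ^ e)).subset fun _ hu => ⟨hu.1, h.lt_of_mem_diff hu⟩

lemma pow_nsmul_mem (h : IsPSystem p a S κ M T) {e : ℕ} {u : Fin d → ℤ} (hu : u ∈ T e) (k : ℕ) :
    p ^ k • u ∈ T (e + k) := by
  induction k with
  | zero => simpa using hu
  | succ k ih =>
    rw [pow_succ', mul_smul, ← add_assoc]
    exact h.nsmul_mem _ _ ih

lemma ncard_shift_le (h : IsPSystem p a S κ M T) {w : Fin d → ℤ} (hw : w ∈ S) (t : ℝ) :
    {u | u ∈ S ∧ u - w ∉ S ∧ latticeMap a u < t}.ncard ≤ (gap S a t ‖realVec w‖).ncard := by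
  refine Set.ncard_le_ncard_of_injOn (fun u => u - w) ?_ (sub_left_injective.injOn)
    (finite_gap h.pos h.pointed _ _)
  rintro u ⟨hu, huw, hut⟩
  refine ⟨huw, ?_, realVec w, le_rfl, ?_⟩
  · rw [map_sub]
    linarith [h.nonneg hw]
  · rw [← map_add, sub_add_cancel]
    exact realVec_mem_realCone hu

/-- A single x ∈ T e gives p^k x + S ⊆ T (e + k), so subtracting p^k x moves every missing point
outside S, yet at most p^k ‖x‖ away from the cone. -/
lemma ncard_diff_le_of_mem (h : IsPSystem p a S κ M T) {e : ℕ} {x : Fin d → ℤ} (hx : x ∈ T e)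
    (k : ℕ) : ((S : Set (Fin d → ℤ)) \ T (e + k)).ncard ≤
      (gap S a (M * (p : ℝ) ^ (e + k)) ((p : ℝ) ^ k * ‖realVec x‖)).ncard := by
  refine Set.ncard_le_ncard_of_injOn (fun u => u - p ^ k • x) ?_ (sub_left_injective.injOn)
    (finite_gap h.pos h.pointed _ _)
  intro u hu
  have hxS : p ^ k • x ∈ S := _root_.nsmul_mem (h.subset _ _ hx) _
  refine ⟨fun hS => hu.2 ?_, ?_, realVec (p ^ k • x), ?_, ?_⟩
  · have := h.add_mem _ _ (h.pow_nsmul_mem hx k) _ hS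
    rwa [add_sub_cancel] at this
  · rw [map_sub]
    linarith [h.nonneg hxS, h.lt_of_mem_diff hu]
  · rw [map_nsmul, ← Nat.cast_smul_eq_nsmul ℝ, norm_smul]
    simp
  · rw [← map_add, sub_add_cancel]
    exact realVec_mem_realCone hu.1

/-- Division by q = p^k gives u = q v + (c + q g), where c is the vector of remainders; the shift by
g puts c + q g in S. If v were in T e, then u would be in T (e + k). There are q^d choices of c. -/
lemma ncard_diff_add_le (h : IsPSystem p a S κ M T) (hp : 0 < p) {g : Fin d → ℤ}
    (hg : ∀ (b : Fin d → ℤ) (c : ℕ), (∀ i, |b i| ≤ c) → b + c • g ∈ S) (e k : ℕ) :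
    ((S : Set (Fin d → ℤ)) \ T (e + k)).ncard ≤ (p ^ k) ^ d *
      (((S : Set (Fin d → ℤ)) \ T e).ncard +
        (gap S a (M * (p : ℝ) ^ e) (1 + ‖realVec g‖)).ncard) := by
  set q : ℕ := p ^ k with hq
  have hq0 : 0 < q := pow_pos hp k
  have hqZ : (0 : ℤ) < q := by exact_mod_cast hq0
  have hqR : (0 : ℝ) < q := by exact_mod_cast hq0
  set U : Set (Fin d → ℤ) := ((S : Set (Fin d → ℤ)) \ T e) ∪
    gap S a (M * (p : ℝ) ^ e) (1 + ‖realVec g‖) with hU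
  set W : Set (Fin d → ℤ) := Set.Icc 0 (fun _ => (q : ℤ) - 1) with hW
  have hUfin : U.Finite := (h.finite_diff e).union (finite_gap h.pos h.pointed _ _)
  have hWfin : W.Finite := Set.finite_Icc _ _
  have hWcard : W.ncard = q ^ d := by
    rw [hW, ← Finset.coe_Icc, Set.ncard_coe_finset, Pi.card_Icc]
    simp
  have hle : ((S : Set (Fin d → ℤ)) \ T (e + k)).ncard ≤ (W ×ˢ U).ncard := by
    refine Set.ncard_le_ncard_of_injOn
      (fun u => ((fun i => u i % q), (fun i => u i / q) - g)) ?_ ?_ (hWfin.prod hUfin)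
    · intro u hu
      set c : Fin d → ℤ := fun i => u i % q with hc
      set v : Fin d → ℤ := (fun i => u i / q) - g with hv
      have hc0 : ∀ i, 0 ≤ c i := fun i => Int.emod_nonneg _ hqZ.ne'
      have hc1 : ∀ i, c i < q := fun i => Int.emod_lt_of_pos _ hqZ
      have hr : c + q • g ∈ S := hg c q fun i => by
        rw [abs_of_nonneg (hc0 i)]; exact (hc1 i).le
      have huv : u = q • v + (c + q • g) := by
        ext i
        change u i = q • (u i / q - g i) + (u i % q + q • g i)
        simp only [nsmul_eq_mul]
        linarith [Int.emod_add_mul_ediv (u i) q]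
      refine ⟨⟨hc0, fun i => Int.le_sub_one_of_lt (hc1 i)⟩, ?_⟩
      have hvT : v ∉ T e := fun hvT => hu.2 (by
        rw [huv]; exact h.add_mem _ _ (h.pow_nsmul_mem hvT k) _ hr)
      by_cases hvS : v ∈ S
      · exact Or.inl ⟨hvS, hvT⟩
      -- Adding (c + q g)/q, of norm at most 1 + ‖g‖, to v gives u/q, a point of the cone.
      · refine Or.inr ⟨hvS, ?_, (q : ℝ)⁻¹ • realVec (c + q • g), ?_, ?_⟩
        · have h1 := h.lt_of_mem_diff hu
          rw [huv, map_add, map_nsmul, nsmul_eq_mul, pow_add] at h1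
          have h2 := h.nonneg hr
          have h3 : (q : ℝ) = (p : ℝ) ^ k := by simp [hq]
          rw [← h3] at h1
          by_contra hcon
          push Not at hcon
          nlinarith [mul_le_mul_of_nonneg_left hcon hqR.le]
        · rw [map_add, map_nsmul, ← Nat.cast_smul_eq_nsmul ℝ, smul_add, smul_smul,
            inv_mul_cancel₀ hqR.ne', one_smul]
          refine (norm_add_le _ _).trans (add_le_add_left ?_ _)
          rw [norm_smul, norm_inv, Real.norm_of_nonneg hqR.le, inv_mul_le_iff₀ hqR, mul_one]
          refine (pi_norm_le_iff_of_nonneg hqR.le).2 fun i => ?_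
          rw [realVec_apply, Real.norm_eq_abs, abs_of_nonneg (by exact_mod_cast hc0 i)]
          exact_mod_cast (hc1 i).le
        · have h4 : realVec v + (q : ℝ)⁻¹ • realVec (c + q • g) = (q : ℝ)⁻¹ • realVec u := by
            have h5 := congrArg realVec huv
            rw [map_add, map_nsmul, ← Nat.cast_smul_eq_nsmul ℝ] at h5
            rw [h5, smul_add, smul_smul, inv_mul_cancel₀ hqR.ne', one_smul]
          rw [h4]
          exact (realCone (S : Set (Fin d → ℤ))).smul_mem (inv_nonneg.2 hqR.le)
            (realVec_mem_realCone hu.1)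
    · intro u _ u' _ huu
      simp only [Prod.mk.injEq, sub_left_inj] at huu
      ext i
      have h1 := congrFun huu.1 i
      have h2 := congrFun huu.2 i
      rw [← Int.emod_add_mul_ediv (u i) q, ← Int.emod_add_mul_ediv (u' i) q, h1, h2]
  refine hle.trans ?_
  rw [Set.ncard_prod, hWcard]
  exact Nat.mul_le_mul_left _ (Set.ncard_union_le _ _)

theorem exists_tendsto (h : IsPSystem p a S κ M T) (hp : 1 < p) :
    ∃ L, Tendsto (fun e => (((S : Set (Fin d → ℤ)) \ T e).ncard : ℝ) / ((p : ℝ) ^ e) ^ d)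
      atTop (𝓝 L) := by
  obtain ⟨g, -, hg⟩ := exists_add_nsmul_mem h.exists_sub
  have hp1 : (1 : ℝ) < p := by exact_mod_cast hp
  have hn : Tendsto (fun e : ℕ => (p : ℝ) ^ e) atTop atTop := tendsto_pow_atTop_atTop_of_one_lt hp1
  refine exists_tendsto_of_le_add (fun e => by positivity)
    (tendsto_ncard_gap h.exists_sub h.pos h.pointed M (ρ := fun _ => 1 + ‖realVec g‖) hn
      (fun e => by positivity) (tendsto_const_nhds.div_atTop hn)) fun e k => ?_
  have h1 := h.ncard_diff_add_le (zero_lt_one.trans hp) hg e k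
  have h2 : (((S : Set (Fin d → ℤ)) \ T (e + k)).ncard : ℝ) ≤ ((p : ℝ) ^ k) ^ d *
      ((((S : Set (Fin d → ℤ)) \ T e).ncard : ℝ) +
        (gap S a (M * (p : ℝ) ^ e) (1 + ‖realVec g‖)).ncard) := by exact_mod_cast h1
  rw [← add_div, div_le_div_iff₀ (by positivity) (by positivity), pow_add, mul_pow]
  have h3 : 0 ≤ ((p : ℝ) ^ e) ^ d := by positivity
  nlinarith [mul_le_mul_of_nonneg_right h2 h3]

/-- Otherwise points x_j ∈ T (e_j) have height below p^{e_j}/(j + 1). By pointedness their norms are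
o(p^{e_j}), so `ncard_diff_le_of_mem` makes the density vanish along a sequence of indices. -/
theorem exists_le_of_pos (h : IsPSystem p a S κ M T) (hp : 1 < p) {L : ℝ}
    (hL : Tendsto (fun e => (((S : Set (Fin d → ℤ)) \ T e).ncard : ℝ) / ((p : ℝ) ^ e) ^ d)
      atTop (𝓝 L)) (hL0 : 0 < L) :
    ∃ ε : ℝ, 0 < ε ∧ ∀ e, ∀ u ∈ T e, ε * (p : ℝ) ^ e ≤ latticeMap a u := by
  by_contra! hcon
  choose e x hx hlt using fun j : ℕ => hcon (1 / ((j : ℝ) + 1)) (by positivity)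
  have hp1 : (1 : ℝ) < p := by exact_mod_cast hp
  -- The e_j may be bounded; adding j makes the indices tend to infinity.
  have hej : Tendsto (fun j => e j + j) atTop atTop :=
    tendsto_atTop_mono (fun j => Nat.le_add_left j (e j)) tendsto_id
  have hn : Tendsto (fun j => (p : ℝ) ^ (e j + j)) atTop atTop :=
    (tendsto_pow_atTop_atTop_of_one_lt hp1).comp hej
  have hρ : Tendsto (fun j => (p : ℝ) ^ j * ‖realVec (x j)‖ / (p : ℝ) ^ (e j + j)) atTop (𝓝 0) := by
    have h0 : Tendsto (fun j : ℕ => 1 / ((j : ℝ) + 1) / κ) atTop (𝓝 0) := by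
      simpa using tendsto_one_div_add_atTop_nhds_zero_nat.div_const κ
    refine squeeze_zero (fun j => by positivity) (fun j => ?_) h0
    have hpe : (0 : ℝ) < (p : ℝ) ^ e j := by positivity
    have hpj : (0 : ℝ) < (p : ℝ) ^ j := by positivity
    rw [pow_add, mul_comm ((p : ℝ) ^ e j), mul_div_mul_left _ _ hpj.ne',
      div_le_div_iff₀ hpe h.pos, mul_comm _ κ]
    exact (h.norm_le (h.subset _ _ (hx j))).trans (hlt j).le
  have h1 := tendsto_ncard_gap h.exists_sub h.pos h.pointed M hn (fun j => by positivity) hρ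
  have h2 := hL.comp hej
  refine hL0.not_ge (le_of_tendsto_of_tendsto' h2 h1 fun j => ?_)
  refine div_le_div_of_nonneg_right ?_ (by positivity)
  exact_mod_cast h.ncard_diff_le_of_mem (hx j) j

/-- The lattice cube of side c translated by c g lies in S, and its heights are at most c K. -/
lemma exists_pow_le_ncard_lt (h : IsPSystem p a S κ M T) :
    ∃ K : ℝ, 0 < K ∧ ∀ t : ℝ, 0 < t →
      (t / K) ^ d ≤ ({u | u ∈ S ∧ latticeMap a u < t}.ncard : ℝ) := by
  obtain ⟨g, hgS, hg⟩ := exists_add_nsmul_mem h.exists_sub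
  have hA : 0 ≤ ∑ i, |a i| := Finset.sum_nonneg fun i _ => abs_nonneg _
  have hg0 := h.nonneg hgS
  refine ⟨(∑ i, |a i|) + latticeMap a g + 1, by linarith, fun t ht => ?_⟩
  set K : ℝ := (∑ i, |a i|) + latticeMap a g + 1 with hK
  have hK0 : 0 < K := by linarith
  have htK : 0 < t / K := div_pos ht hK0
  -- The largest integer below t/K: c K < t stays strict, while c + 1 ≥ t/K bounds the (c + 1)^d
  -- points of the cube from below.
  set c : ℕ := ⌈t / K⌉₊ - 1 with hc
  have hc1 : c + 1 = ⌈t / K⌉₊ := Nat.sub_add_cancel (Nat.ceil_pos.2 htK)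
  have hcK : (c : ℝ) * K < t := by
    rw [← lt_div_iff₀ hK0]
    exact Nat.lt_ceil.1 (by omega)
  have hcard : (Set.Icc (0 : Fin d → ℤ) (fun _ => (c : ℤ))).ncard = (c + 1) ^ d := by
    rw [← Finset.coe_Icc, Set.ncard_coe_finset, Pi.card_Icc]
    simp
  have hle : (Set.Icc (0 : Fin d → ℤ) (fun _ => (c : ℤ))).ncard ≤
      {u | u ∈ S ∧ latticeMap a u < t}.ncard := by
    refine Set.ncard_le_ncard_of_injOn (fun b => b + c • g) ?_ (add_left_injective _).injOn
      (h.finite_lt t)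
    rintro b ⟨hb0, hb1⟩
    refine ⟨hg b c fun i => by rw [abs_of_nonneg (hb0 i)]; exact hb1 i, ?_⟩
    rw [map_add, map_nsmul, nsmul_eq_mul, latticeMap_eq]
    have h1 := (le_abs_self _).trans (abs_dotProduct_le (realVec b) a)
    have h2 : ‖realVec b‖ ≤ c := by
      refine (pi_norm_le_iff_of_nonneg (Nat.cast_nonneg _)).2 fun i => ?_
      rw [realVec_apply, Real.norm_eq_abs, abs_of_nonneg (by exact_mod_cast hb0 i)]
      exact_mod_cast hb1 i
    have h3 := mul_le_mul_of_nonneg_left h2 hA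
    have hc0 : (0 : ℝ) ≤ c := Nat.cast_nonneg _
    nlinarith
  rw [hcard] at hle
  have h4 : ((c : ℝ) + 1) ^ d ≤ ({u | u ∈ S ∧ latticeMap a u < t}.ncard : ℝ) := by
    exact_mod_cast hle
  refine (pow_le_pow_left₀ htK.le ?_ d).trans h4
  have := Nat.le_ceil (t / K)
  rw [← hc1] at this
  exact_mod_cast this

theorem pos_of_eventually_le (h : IsPSystem p a S κ M T) (hp : 0 < p) {L : ℝ}
    (hL : Tendsto (fun e => (((S : Set (Fin d → ℤ)) \ T e).ncard : ℝ) / ((p : ℝ) ^ e) ^ d)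
      atTop (𝓝 L)) {ε : ℝ} (hε : 0 < ε)
    (hT : ∀ᶠ e in atTop, ∀ u ∈ T e, ε * (p : ℝ) ^ e ≤ latticeMap a u) : 0 < L := by
  obtain ⟨K, hK, hcard⟩ := h.exists_pow_le_ncard_lt
  have hp0 : (0 : ℝ) < p := by exact_mod_cast hp
  refine (pow_pos (div_pos hε hK) d).trans_le (ge_of_tendsto hL ?_)
  filter_upwards [hT] with e he
  rw [le_div_iff₀ (by positivity), ← mul_pow, div_mul_eq_mul_div]
  refine (hcard _ (by positivity)).trans ?_
  have hsub : {u | u ∈ S ∧ latticeMap a u < ε * (p : ℝ) ^ e} ⊆ (S : Set (Fin d → ℤ)) \ T e :=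
    fun u hu => ⟨hu.1, fun huT => (he u huT).not_gt hu.2⟩
  exact_mod_cast Set.ncard_le_ncard hsub (h.finite_diff e)

end IsPSystem

end Lattice

/-! ### Lengths of quotients through the filtration by value -/

section Length

open IsLocalRing

/-- N is a quotient of M / ker g, which embeds in P. This compares graded pieces with the residue
field in both directions. -/
lemma length_le_length_of_ker_le {R M N P : Type*} [Ring R] [AddCommGroup M] [AddCommGroup N]
    [AddCommGroup P] [Module R M] [Module R N] [Module R P] (f : M →ₗ[R] N) (g : M →ₗ[R] P)
    (hf : Function.Surjective f) (h : g.ker ≤ f.ker) : Module.length R N ≤ Module.length R P := by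
  have h1 : Module.length R N ≤ Module.length R (M ⧸ g.ker) := by
    refine Module.length_le_of_surjective (g.ker.liftQ f h) fun y => ?_
    obtain ⟨x, rfl⟩ := hf y
    exact ⟨g.ker.mkQ x, by simp⟩
  refine h1.trans (Module.length_le_of_injective (g.ker.liftQ g le_rfl) ?_)
  rw [← LinearMap.ker_eq_bot]
  exact Submodule.ker_liftQ_eq_bot _ _ _ le_rfl

lemma length_quotient_eq_add {R M : Type*} [Ring R] [AddCommGroup M] [Module R M]
    {A B : Submodule R M} (h : A ≤ B) :
    Module.length R (M ⧸ A) = Module.length R (M ⧸ B) + Module.length R (B.map A.mkQ) := by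
  rw [add_comm, ← (Submodule.quotientQuotientEquivQuotient A B h).length_eq]
  refine Module.length_eq_add_of_exact (B.map A.mkQ).subtype (B.map A.mkQ).mkQ
    (Submodule.injective_subtype _) (Submodule.mkQ_surjective _) ?_
  rw [LinearMap.exact_iff]
  simp

variable {R F : Type*} [CommRing R] [Field F] [Algebra R F] (v : AddValuation F (WithTop ℝ))
  (hR : ∀ x : R, 0 ≤ v (algebraMap R F x))

/-- The ideal of all `x ∈ R` with `v x ≥ t`. -/
def geIdeal (t : ℝ) : Ideal R where
  carrier := {x | (t : WithTop ℝ) ≤ v (algebraMap R F x)}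
  zero_mem' := by simp
  add_mem' {x y} hx hy := by
    rw [Set.mem_ofPred_eq, map_add]
    exact v.map_le_add hx hy
  smul_mem' c x hx := by
    rw [Set.mem_ofPred_eq, smul_eq_mul, map_mul, v.map_mul]
    exact le_add_of_nonneg_of_le (hR c) hx

/-- The ideal of all `x ∈ R` with `v x > t`. -/
def gtIdeal (t : ℝ) : Ideal R where
  carrier := {x | (t : WithTop ℝ) < v (algebraMap R F x)}
  zero_mem' := by simp
  add_mem' {x y} hx hy := by
    rw [Set.mem_ofPred_eq, map_add]
    exact v.map_lt_add hx hy
  smul_mem' c x hx := by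
    rw [Set.mem_ofPred_eq, smul_eq_mul, map_mul, v.map_mul]
    exact lt_add_of_nonneg_of_lt (hR c) hx

variable {v hR}

lemma mem_geIdeal {t : ℝ} {x : R} : x ∈ geIdeal v hR t ↔ (t : WithTop ℝ) ≤ v (algebraMap R F x) :=
  Iff.rfl

lemma mem_gtIdeal {t : ℝ} {x : R} : x ∈ gtIdeal v hR t ↔ (t : WithTop ℝ) < v (algebraMap R F x) :=
  Iff.rfl

lemma gtIdeal_le_geIdeal (t : ℝ) : gtIdeal v hR t ≤ geIdeal v hR t :=
  fun _ hx => mem_geIdeal.2 (mem_gtIdeal.1 hx).le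

variable (v R) in
/-- The values of `v` on `R` that are less than `t`. -/
def levels (t : ℝ) : Set ℝ := {r | r < t ∧ ∃ x : R, v (algebraMap R F x) = r}

variable (v hR) in
/-- The length of the graded piece in degree `r` of `R / J`. -/
def gradedLength (J : Ideal R) (r : ℝ) : ℕ∞ :=
  Module.length R (Submodule.map (J ⊔ gtIdeal v hR r).mkQ (geIdeal v hR r))

/-- If r is the largest value below t, then R_{≥t} = R_{>r}; passing from J + R_{>r} to J + R_{≥r}
splits off the graded piece in degree r and leaves one level fewer. -/
lemma length_quotient_sup_geIdeal (hfin : ∀ t, (levels R v t).Finite) (J : Ideal R) (t : ℝ) :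
    Module.length R (R ⧸ (J ⊔ geIdeal v hR t)) =
      ∑ r ∈ (hfin t).toFinset, gradedLength v hR J r := by
  induction hn : (hfin t).toFinset.card generalizing t with
  | zero =>
    rw [Finset.card_eq_zero] at hn
    have htop : geIdeal v hR t = ⊤ := by
      refine (Ideal.eq_top_iff_one _).2 (mem_geIdeal.2 (le_of_not_gt fun hlt => ?_))
      have h1 : (0 : ℝ) ∈ (hfin t).toFinset := by
        rw [Set.Finite.mem_toFinset]
        refine ⟨?_, 1, by simp⟩
        rw [map_one, v.map_one] at hlt
        exact_mod_cast hlt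
      simp [hn] at h1
    rw [hn, htop, sup_top_eq, Finset.sum_empty, Module.length_eq_zero_iff]
    exact Submodule.Quotient.subsingleton_iff.2 rfl
  | succ m ih =>
    have hne : (hfin t).toFinset.Nonempty := Finset.card_pos.1 (by omega)
    set r := (hfin t).toFinset.max' hne with hr
    have hrt : r ∈ levels R v t := (hfin t).mem_toFinset.1 (Finset.max'_mem _ hne)
    have hmax : ∀ s ∈ levels R v t, s ≤ r := fun s hs =>
      Finset.le_max' _ _ ((hfin t).mem_toFinset.2 hs)
    have heq : geIdeal v hR t = gtIdeal v hR r := by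
      refine le_antisymm (fun x hx => ?_) (fun x hx => ?_)
      · exact mem_gtIdeal.2 (lt_of_lt_of_le (by exact_mod_cast hrt.1) (mem_geIdeal.1 hx))
      · refine mem_geIdeal.2 (le_of_not_gt fun hlt => ?_)
        obtain ⟨s, hs⟩ := WithTop.ne_top_iff_exists.1 (ne_top_of_lt hlt)
        have h1 : s ∈ levels R v t := ⟨by rw [← hs] at hlt; exact_mod_cast hlt, x, hs.symm⟩
        have h2 : (r : WithTop ℝ) < v (algebraMap R F x) := hx
        rw [← hs] at h2
        exact (hmax s h1).not_gt (by exact_mod_cast h2)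
    have hset : (hfin t).toFinset = insert r (hfin r).toFinset := by
      ext s
      simp only [Set.Finite.mem_toFinset, Finset.mem_insert]
      constructor
      · intro hs
        rcases (hmax s hs).eq_or_lt with h | h
        · exact Or.inl h
        · exact Or.inr ⟨h, hs.2⟩
      · rintro (rfl | hs)
        · exact hrt
        · exact ⟨hs.1.trans hrt.1, hs.2⟩
    have hnot : r ∉ (hfin r).toFinset := fun h => lt_irrefl r ((hfin r).mem_toFinset.1 h).1
    have hcard : (hfin r).toFinset.card = m := by
      rw [hset, Finset.card_insert_of_notMem hnot] at hn
      omega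
    have hmap : Submodule.map (J ⊔ gtIdeal v hR r).mkQ (J ⊔ geIdeal v hR r) =
        Submodule.map (J ⊔ gtIdeal v hR r).mkQ (geIdeal v hR r) := by
      refine (Submodule.map_sup _ _ _).trans (sup_eq_right.2 ?_)
      rw [Submodule.map_le_iff_le_comap]
      intro x hx
      have : (J ⊔ gtIdeal v hR r).mkQ x = 0 := by
        rw [Submodule.mkQ_apply, Submodule.Quotient.mk_eq_zero]
        exact Submodule.mem_sup_left hx
      rw [Submodule.mem_comap, this]
      exact zero_mem _
    rw [hset, Finset.sum_insert hnot, ← ih r hcard, heq,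
      length_quotient_eq_add (sup_le_sup_left (gtIdeal_le_geIdeal r) J), add_comm, gradedLength,
      hmap]

lemma gradedLength_eq_zero {J : Ideal R} {r : ℝ} (h : geIdeal v hR r ≤ J ⊔ gtIdeal v hR r) :
    gradedLength v hR J r = 0 := by
  rw [gradedLength, Module.length_eq_zero_iff, Submodule.subsingleton_iff_eq_bot, eq_bot_iff,
    Submodule.map_le_iff_le_comap, Submodule.comap_bot, Submodule.ker_mkQ]
  exact h

variable {V : ValuationSubring F} (hV : ∀ x, x ∈ V ↔ 0 ≤ v x) [Algebra R V]
  (hA : ∀ x : R, ((algebraMap R V x : V) : F) = algebraMap R F x)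

include hV in
lemma residue_eq_zero_iff_pos (z : V) : residue V z = 0 ↔ 0 < v (z : F) := by
  rw [residue_eq_zero_iff, mem_maximalIdeal, mem_nonunits_iff]
  have hz : 0 ≤ v (z : F) := (hV _).1 z.2
  constructor
  · intro h
    refine lt_of_le_of_ne hz fun h0 => h ?_
    have hz0 : (z : F) ≠ 0 := by
      intro h1
      rw [h1, v.map_zero] at h0
      exact WithTop.top_ne_zero h0.symm
    have h1 : v (z : F) + v (z : F)⁻¹ = 0 := by
      rw [← v.map_mul, mul_inv_cancel₀ hz0, v.map_one]
    rw [← h0, zero_add] at h1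
    exact IsUnit.of_mul_eq_one ⟨(z : F)⁻¹, (hV _).2 h1.ge⟩ (Subtype.ext (mul_inv_cancel₀ hz0))
  · rintro h hu
    obtain ⟨w, hw⟩ := hu.exists_right_inv
    have h1 : v (z : F) + v (w : F) = 0 := by
      rw [← v.map_mul, ← v.map_one]
      exact congrArg v (congrArg Subtype.val hw)
    exact (add_pos_of_pos_of_nonneg h ((hV _).1 w.2)).ne' h1

lemma addValuation_div_eq {y x : F} {r s : ℝ} (hx : v x = s) (hy : v y = r) :
    v (x / y) = ((s - r : ℝ) : WithTop ℝ) := by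
  have hy0 : y ≠ 0 := by
    rintro rfl
    rw [v.map_zero] at hy
    exact WithTop.coe_ne_top hy.symm
  have h : v (x / y) + v y = v x := by rw [← v.map_mul, div_mul_cancel₀ _ hy0]
  rw [hx, hy] at h
  obtain ⟨q, hq⟩ := WithTop.ne_top_iff_exists.1
    (show v (x / y) ≠ ⊤ by intro h1; rw [h1, top_add] at h; exact WithTop.coe_ne_top h.symm)
  rw [← hq] at h ⊢
  norm_cast at h ⊢
  linarith

lemma addValuation_div_nonneg_iff {y x : F} {r : ℝ} (hy : v y = r) :
    0 ≤ v (x / y) ↔ (r : WithTop ℝ) ≤ v x := by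
  rcases eq_or_ne (v x) ⊤ with hx | hx
  · rw [v.top_iff] at hx
    simp [hx]
  · obtain ⟨s, hs⟩ := WithTop.ne_top_iff_exists.1 hx
    rw [addValuation_div_eq hs.symm hy, ← hs]
    norm_cast
    exact sub_nonneg

lemma addValuation_div_pos_iff {y x : F} {r : ℝ} (hy : v y = r) :
    0 < v (x / y) ↔ (r : WithTop ℝ) < v x := by
  rcases eq_or_ne (v x) ⊤ with hx | hx
  · rw [v.top_iff] at hx
    simp [hx]
  · obtain ⟨s, hs⟩ := WithTop.ne_top_iff_exists.1 hx
    rw [addValuation_div_eq hs.symm hy, ← hs]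
    norm_cast
    exact sub_pos

/-- The leading coefficient map from `R_{≥ r}` to the residue field of `V`, relative to an element
`y` of value `r`. -/
def leadingCoeff {y : F} {r : ℝ} (hy : v y = r) : geIdeal v hR r →ₗ[R] ResidueField V where
  toFun x := residue V ⟨algebraMap R F x / y, (hV _).2 ((addValuation_div_nonneg_iff hy).2 x.2)⟩
  map_add' x x' := by
    rw [← map_add]
    congr 1
    ext
    simp [add_div]
  map_smul' c x := by
    rw [RingHom.id_apply, Algebra.smul_def, IsScalarTower.algebraMap_apply R V (ResidueField V),
      ResidueField.algebraMap_eq, ← map_mul]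
    congr 1
    ext
    simp [hA, mul_div_assoc]

lemma leadingCoeff_eq_zero_iff {y : F} {r : ℝ} (hy : v y = r) (x : geIdeal v hR r) :
    leadingCoeff hV hA hy x = 0 ↔ (x : R) ∈ gtIdeal v hR r :=
  (residue_eq_zero_iff_pos hV _).trans (addValuation_div_pos_iff hy)

/-- The map from `R_{≥ r}` onto the graded piece in degree `r` of `R / J`. -/
def toGraded (J : Ideal R) (r : ℝ) :
    geIdeal v hR r →ₗ[R] Submodule.map (J ⊔ gtIdeal v hR r).mkQ (geIdeal v hR r) :=
  (J ⊔ gtIdeal v hR r).mkQ.submoduleMap (geIdeal v hR r)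

lemma toGraded_eq_zero_iff (J : Ideal R) (r : ℝ) (x : geIdeal v hR r) :
    toGraded J r x = 0 ↔ (x : R) ∈ J ⊔ gtIdeal v hR r := by
  rw [← Submodule.Quotient.mk_eq_zero, ← Subtype.coe_inj]
  rfl

include hV hA in
-- An element whose leading coefficient vanishes has value above r, so it dies in the graded piece.
lemma gradedLength_le {J : Ideal R} {y : F} {r : ℝ} (hy : v y = r) :
    gradedLength v hR J r ≤ Module.length R (ResidueField V) := by
  refine length_le_length_of_ker_le (toGraded J r) (leadingCoeff hV hA hy)
    (LinearMap.submoduleMap_surjective _ _) fun x hx => ?_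
  rw [LinearMap.mem_ker, leadingCoeff_eq_zero_iff] at hx
  rw [LinearMap.mem_ker, toGraded_eq_zero_iff]
  exact Submodule.mem_sup_right hx

include hV hA in
-- Relative to s b, the products s f have leading coefficients the residues of f/b, which exhaust
-- the residue field. As J omits the value r, an element of R_{≥r} that dies in the graded piece has
-- value above r.
lemma le_gradedLength {J : Ideal R} {b : R} {t : ℝ} (hb : v (algebraMap R F b) = t)
    (hbV : ∀ ξ : F, 0 ≤ v ξ → ∃ f : R, 0 < v (ξ - algebraMap R F f / algebraMap R F b))
    {s : R} {r : ℝ} (hs : v (algebraMap R F s) = ((r - t : ℝ) : WithTop ℝ))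
    (hJ : ∀ j ∈ J, v (algebraMap R F j) ≠ r) :
    Module.length R (ResidueField V) ≤ gradedLength v hR J r := by
  have hsb : v (algebraMap R F s * algebraMap R F b) = r := by
    rw [v.map_mul, hs, hb]
    norm_cast
    simp
  refine length_le_length_of_ker_le (leadingCoeff hV hA hsb) (toGraded J r) ?_ fun x hx => ?_
  · intro ζ
    obtain ⟨ξ, rfl⟩ := residue_surjective ζ
    obtain ⟨f, hf⟩ := hbV ξ ((hV _).1 ξ.2)
    have hs0 : algebraMap R F s ≠ 0 := by
      intro h
      rw [h, v.map_zero] at hs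
      exact WithTop.coe_ne_top hs.symm
    have h1 : algebraMap R F (s * f) / (algebraMap R F s * algebraMap R F b) =
        algebraMap R F f / algebraMap R F b := by
      rw [map_mul, mul_div_mul_left _ _ hs0]
    have h2 : 0 ≤ v (algebraMap R F f / algebraMap R F b) := by
      have := v.map_sub ξ (ξ - algebraMap R F f / algebraMap R F b)
      rw [sub_sub_cancel] at this
      exact (le_min ((hV _).1 ξ.2) hf.le).trans this
    refine ⟨⟨s * f, (addValuation_div_nonneg_iff hsb).1 (h1 ▸ h2)⟩, ?_⟩
    rw [eq_comm, ← sub_eq_zero]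
    simp only [leadingCoeff, LinearMap.coe_mk, AddHom.coe_mk]
    rw [← map_sub, residue_eq_zero_iff_pos hV]
    rw [← h1] at hf
    exact hf
  · rw [LinearMap.mem_ker, toGraded_eq_zero_iff] at hx
    rw [LinearMap.mem_ker, leadingCoeff_eq_zero_iff]
    obtain ⟨j, hj, z, hz, hjz⟩ := Submodule.mem_sup.1 hx
    have h1 : (r : WithTop ℝ) ≤ v (algebraMap R F j) := by
      have h2 := (geIdeal v hR r).sub_mem x.2 (gtIdeal_le_geIdeal r hz)
      rwa [← hjz, add_sub_cancel_right] at h2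
    rw [← hjz]
    exact (gtIdeal v hR r).add_mem (lt_of_le_of_ne h1 (hJ j hj).symm) hz

/-- The leading term of any z ∈ R_{≥r} is cancelled by some s f, which lies in J. -/
lemma gradedLength_eq_zero_of_mem {J : Ideal R} {b : R} {t : ℝ} (hb : v (algebraMap R F b) = t)
    (hbV : ∀ ξ : F, 0 ≤ v ξ → ∃ f : R, 0 < v (ξ - algebraMap R F f / algebraMap R F b))
    {s : R} (hsJ : s ∈ J) {r : ℝ} (hs : v (algebraMap R F s) = ((r - t : ℝ) : WithTop ℝ)) :
    gradedLength v hR J r = 0 := by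
  have hsb : v (algebraMap R F s * algebraMap R F b) = r := by
    rw [v.map_mul, hs, hb]
    norm_cast
    simp
  have hsb0 : algebraMap R F s * algebraMap R F b ≠ 0 := by
    intro h
    rw [h, v.map_zero] at hsb
    exact WithTop.coe_ne_top hsb.symm
  refine gradedLength_eq_zero fun z hz => ?_
  obtain ⟨f, hf⟩ := hbV _ ((addValuation_div_nonneg_iff hsb).2 hz)
  have h1 : algebraMap R F z / (algebraMap R F s * algebraMap R F b) -
      algebraMap R F f / algebraMap R F b =
      algebraMap R F (z - s * f) / (algebraMap R F s * algebraMap R F b) := by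
    rw [map_sub, sub_div, map_mul, mul_div_mul_left _ _ (left_ne_zero_of_mul hsb0)]
  rw [h1, addValuation_div_pos_iff hsb] at hf
  have h2 : z = s * f + (z - s * f) := by ring
  rw [h2]
  exact Submodule.add_mem_sup (J.mul_mem_right f hsJ) (mem_gtIdeal.2 hf)

/-- Take b to be a common denominator of lifts of finitely many R-generators of the residue field.
-/
lemma exists_lift_residue [IsDomain R] [IsFractionRing R F]
    (hfin : Module.Finite R (ResidueField V))
    (hV : ∀ x, x ∈ V ↔ 0 ≤ v x)
    (hA : ∀ x : R, ((algebraMap R V x : V) : F) = algebraMap R F x) :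
    ∃ b : R, b ≠ 0 ∧
      ∀ ξ : F, 0 ≤ v ξ → ∃ f : R, 0 < v (ξ - algebraMap R F f / algebraMap R F b) := by
  classical
  obtain ⟨A, hAtop⟩ := hfin.fg_top
  choose lift hlift using residue_surjective (R := V)
  obtain ⟨b, hb⟩ := IsLocalization.exist_integer_multiples_of_finset (nonZeroDivisors R)
    (A.image fun ζ => (lift ζ : F))
  have hbF : algebraMap R F b ≠ 0 := by simp
  refine ⟨b, nonZeroDivisors.ne_zero b.2, fun ξ hξ => ?_⟩
  have hspan : ∀ ζ ∈ Submodule.span R (A : Set (ResidueField V)), ∃ (f : R) (z : V),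
      (z : F) = algebraMap R F f / algebraMap R F b ∧ residue V z = ζ := by
    intro ζ hζ
    induction hζ using Submodule.span_induction with
    | mem ζ hζ =>
      obtain ⟨f, hf⟩ := hb (lift ζ : F) (Finset.mem_image_of_mem _ hζ)
      refine ⟨f, lift ζ, ?_, hlift ζ⟩
      rw [hf, eq_div_iff hbF, mul_comm, Algebra.smul_def]
    | zero => exact ⟨0, 0, by simp, by simp⟩
    | add x y _ _ hx hy =>
      obtain ⟨f, z, hz, rfl⟩ := hx
      obtain ⟨g, w, hw, rfl⟩ := hy
      exact ⟨f + g, z + w, by simp [hz, hw, add_div], by simp⟩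
    | smul c x _ hx =>
      obtain ⟨f, z, hz, rfl⟩ := hx
      refine ⟨c * f, algebraMap R V c * z, by simp [hz, hA, mul_div_assoc], ?_⟩
      rw [map_mul, Algebra.smul_def, IsScalarTower.algebraMap_apply R V (ResidueField V),
        ResidueField.algebraMap_eq]
  obtain ⟨f, z, hz, hzξ⟩ := hspan (residue V ⟨ξ, (hV ξ).2 hξ⟩) (hAtop ▸ Submodule.mem_top)
  refine ⟨f, ?_⟩
  rw [eq_comm, ← sub_eq_zero, ← map_sub, residue_eq_zero_iff_pos hV] at hzξ
  simpa only [AddSubgroupClass.coe_sub, hz] using hzξ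

end Length

/-! ### Ordinary powers against Frobenius powers -/

section FrobeniusPow

/-- Pigeonhole: in a monomial of such a degree some generator has exponent at least n. The induction
peels off one generator and n factors at a time. -/
lemma span_pow_card_mul_le {R : Type*} [CommRing R] (s : Finset R) {n : ℕ} (hn : n ≠ 0) :
    Ideal.span (s : Set R) ^ ((s.card + 1) * n) ≤ Ideal.span ((fun x => x ^ n) '' (s : Set R)) := by
  classical
  induction s using Finset.induction_on with
  | empty => simp [hn]
  | insert x s hx ih =>
    rw [Finset.coe_insert, Ideal.span_insert, Finset.card_insert_of_notMem hx, add_mul (_ + 1),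
      one_mul, add_comm, Set.image_insert_eq, Ideal.span_insert]
    refine Ideal.sup_pow_add_le_pow_sup_pow.trans (sup_le_sup ?_ ih)
    rw [Ideal.span_singleton_pow]

lemma exists_pow_mul_le_frobeniusPow {R : Type*} [CommRing R] {I : Ideal R} (hI : I.FG) :
    ∃ N : ℕ, ∀ n ≠ 0, I ^ (N * n) ≤ frobeniusPow I n := by
  obtain ⟨s, rfl⟩ := hI
  exact ⟨s.card + 1, fun n hn => (span_pow_card_mul_le s hn).trans
    (Ideal.span_mono (Set.image_mono Ideal.subset_span))⟩

lemma IsPFamily.pow_mem {R : Type*} [CommRing R] {p : ℕ} {I : ℕ → Ideal R} (hI : IsPFamily p I)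
    {e : ℕ} {x : R} (hx : x ∈ I e) : x ^ p ∈ I (e + 1) :=
  hI e (Ideal.subset_span ⟨x, hx, rfl⟩)

lemma IsPFamily.frobeniusPow_le {R : Type*} [CommRing R] {p : ℕ} {I : ℕ → Ideal R}
    (hI : IsPFamily p I) (e : ℕ) : frobeniusPow (I 0) (p ^ e) ≤ I e := by
  refine Ideal.span_le.2 ?_
  rintro _ ⟨x, hx, rfl⟩
  induction e with
  | zero => simpa using hx
  | succ e ih =>
    change x ^ p ^ (e + 1) ∈ I (e + 1)
    rw [pow_succ, pow_mul]
    exact hI.pow_mem ih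

/-- If 𝔪^c ⊆ I_0, then 𝔪^{cNq} ⊆ I_0^{Nq} ⊆ I_0^{[q]} ⊆ I_q, an exponent linear in q. -/
lemma IsPFamily.exists_pow_le {R : Type*} [CommRing R] [IsNoetherianRing R] {p : ℕ}
    (hp : p ≠ 0) {I : ℕ → Ideal R} (hI : IsPFamily p I) {m : Ideal R} (hm : m ≤ (I 0).radical) :
    ∃ N : ℕ, ∀ e, m ^ (N * p ^ e) ≤ I e := by
  obtain ⟨c, hc⟩ := Ideal.exists_pow_le_of_le_radical_of_fg hm (IsNoetherian.noetherian m)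
  obtain ⟨N, hN⟩ := exists_pow_mul_le_frobeniusPow (IsNoetherian.noetherian (I 0))
  refine ⟨c * N, fun e => ?_⟩
  rw [mul_assoc, pow_mul]
  exact (Ideal.pow_right_mono hc _).trans ((hN _ (pow_ne_zero e hp)).trans (hI.frobeniusPow_le e))

end FrobeniusPow

section Residue

open IsLocalRing

lemma finite_residueField {R V : Type*} [CommRing R] [IsLocalRing R] [CommRing V] [IsLocalRing V]
    [Algebra R V] [IsLocalHom (algebraMap R V)]
    (h : (ResidueField.map (algebraMap R V)).Finite) :
    Module.Finite R (ResidueField V) ∧ Module.length R (ResidueField V) ≠ ⊤ := by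
  have h1 : Module.Finite (ResidueField R) (ResidueField V) :=
    RingHom.finite_algebraMap.1 h
  refine ⟨Module.Finite.trans (ResidueField R) _, ?_⟩
  rw [Module.length_eq_of_surjective (R := ResidueField R) residue_surjective]
  exact Module.length_ne_top

end Residue

/-! ### The real-valued valuation and the value semigroup -/

namespace LatticeValuation

variable {F : Type*} [Field F] {d : ℕ} {a : Fin d → ℝ} (ν : LatticeValuation F a)

lemma val_mul (x y : Fˣ) : ν.val (x * y) = ν.val x + ν.val y := by simp [val]

lemma val_one : ν.val 1 = 0 := by simp [val]

open Classical in
/-- The real-valued additive valuation `x ↦ ⟨ν x, a⟩`. -/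
def ord : AddValuation F (WithTop ℝ) :=
  AddValuation.of
    (fun x => if h : x = 0 then ⊤ else ((latticeMap a (ν.val (Units.mk0 x h)) : ℝ) : WithTop ℝ))
    (by simp)
    (by simp [val_one])
    (by
      intro x y
      by_cases hx : x = 0
      · simp [hx]
      by_cases hy : y = 0
      · simp [hy]
      by_cases hxy : x + y = 0
      · simp [hxy]
      simp only [hx, hy, hxy, dite_false]
      rw [← WithTop.coe_min, WithTop.coe_le_coe]
      exact ν.min_le_add (Units.mk0 x hx) (Units.mk0 y hy) (Units.mk0 (x + y) hxy) rfl)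
    (by
      intro x y
      by_cases hx : x = 0
      · simp [hx]
      by_cases hy : y = 0
      · simp [hy]
      simp only [hx, hy, mul_eq_zero, or_self, dite_false]
      rw [← WithTop.coe_add, WithTop.coe_inj, ← map_add, ← val_mul]
      congr 2
      ext
      rfl)

lemma ord_unit (y : Fˣ) : ν.ord y = ((latticeMap a (ν.val y) : ℝ) : WithTop ℝ) := by
  simp [ord, AddValuation.of_apply]

lemma exists_unit_of_ord_eq {x : F} {r : ℝ} (h : ν.ord x = r) :
    ∃ y : Fˣ, (y : F) = x ∧ latticeMap a (ν.val y) = r := by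
  have hx : x ≠ 0 := by
    rintro rfl
    rw [ν.ord.map_zero] at h
    exact WithTop.coe_ne_top h.symm
  refine ⟨Units.mk0 x hx, rfl, ?_⟩
  rw [← WithTop.coe_inj, ← ord_unit, ← h]
  rfl

lemma mem_geq_iff {u : Fin d → ℤ} {x : F} :
    x ∈ ν.geq u ↔ ((latticeMap a u : ℝ) : WithTop ℝ) ≤ ν.ord x := by
  constructor
  · intro h
    rcases eq_or_ne x 0 with rfl | hx
    · simp
    · have h1 := h (Units.mk0 x hx) rfl
      rw [← WithTop.coe_le_coe, ← ord_unit] at h1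
      exact h1
  · rintro h y rfl
    rw [ord_unit] at h
    exact WithTop.coe_le_coe.1 h

lemma mem_ring_iff {x : F} : x ∈ ν.ring ↔ 0 ≤ ν.ord x := by
  have h : x ∈ ν.ring ↔ x ∈ ν.geq 0 := Iff.rfl
  rw [h, mem_geq_iff, map_zero, WithTop.coe_zero]

variable {R : Type*} [CommRing R] [Algebra R F]

/-- The set `ν(J)` of the values of the nonzero elements of an ideal `J`. -/
def valueSet (J : Ideal R) : Set (Fin d → ℤ) :=
  {u | ∃ x ∈ J, ν.ord (algebraMap R F x) = ((latticeMap a u : ℝ) : WithTop ℝ)}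

variable (R) in
/-- The semigroup `ν(R)`. -/
def valueSemigroup : AddSubmonoid (Fin d → ℤ) where
  carrier := ν.valueSet (⊤ : Ideal R)
  zero_mem' := ⟨1, trivial, by simp⟩
  add_mem' := by
    rintro u w ⟨x, -, hx⟩ ⟨y, -, hy⟩
    exact ⟨x * y, trivial, by rw [map_mul, ν.ord.map_mul, hx, hy, map_add, WithTop.coe_add]⟩

lemma valueSet_subset (J : Ideal R) : ν.valueSet J ⊆ ν.valueSemigroup R :=
  fun _ ⟨x, _, h⟩ => ⟨x, trivial, h⟩

lemma val_mem_valueSet {J : Ideal R} {x : R} (hx : x ∈ J) {y : Fˣ} (hy : (y : F) = algebraMap R F x) :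
    ν.val y ∈ ν.valueSet J :=
  ⟨x, hx, by rw [← hy, ord_unit]⟩

lemma realVec_mem_semigroup {u : Fin d → ℤ} (hu : u ∈ ν.valueSemigroup R) :
    realVec u ∈ ν.semigroup R := by
  obtain ⟨x, -, hx⟩ := hu
  obtain ⟨y, hy, hyu⟩ := ν.exists_unit_of_ord_eq hx
  refine ⟨x, y, hy, ?_⟩
  rw [ν.embedding hyu]
  rfl

lemma realCone_valueSemigroup_subset :
    (realCone (ν.valueSemigroup R : Set (Fin d → ℤ)) : Set (Fin d → ℝ)) ⊆ ν.closedCone R := by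
  refine subset_trans ?_ subset_closure
  refine Submodule.span_mono ?_
  rintro _ ⟨u, hu, rfl⟩
  exact ν.realVec_mem_semigroup hu

lemma smul_mem_closedCone {w : Fin d → ℝ} (hw : w ∈ ν.closedCone R) {c : ℝ} (hc : 0 ≤ c) :
    c • w ∈ ν.closedCone R :=
  map_mem_closure (continuous_const_smul c) hw fun _ hx =>
    (PointedCone.hull ℝ (ν.semigroup R)).smul_mem hc hx

/-- The height attains a positive minimum on the compact unit slice of the cone; here it matters
that the cone is closed. -/
lemma exists_mul_norm_le (hp : ∀ w ∈ ν.closedCone R, w ≠ 0 → 0 < w ⬝ᵥ a) :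
    ∃ κ : ℝ, 0 < κ ∧ ∀ w ∈ ν.closedCone R, κ * ‖w‖ ≤ w ⬝ᵥ a := by
  have hcomp : IsCompact (ν.closedCone R ∩ Metric.sphere 0 1) :=
    (isCompact_sphere 0 1).inter_left isClosed_closure
  have hcont : Continuous fun w : Fin d → ℝ => w ⬝ᵥ a := by
    unfold dotProduct
    fun_prop
  obtain ⟨κ, hκ, hmin⟩ : ∃ κ : ℝ, 0 < κ ∧ ∀ w ∈ ν.closedCone R ∩ Metric.sphere 0 1, κ ≤ w ⬝ᵥ a := by
    rcases (ν.closedCone R ∩ Metric.sphere 0 1).eq_empty_or_nonempty with he | hne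
    · exact ⟨1, one_pos, by simp [he]⟩
    · obtain ⟨w, hw, hmin⟩ := hcomp.exists_isMinOn hne hcont.continuousOn
      exact ⟨_, hp w hw.1 (ne_zero_of_mem_unit_sphere ⟨w, hw.2⟩), fun z hz => hmin hz⟩
  refine ⟨κ, hκ, fun w hw => ?_⟩
  rcases eq_or_ne w 0 with rfl | hw0
  · simp
  · have hn : 0 < ‖w‖ := norm_pos_iff.2 hw0
    have h1 := hmin (‖w‖⁻¹ • w) ⟨ν.smul_mem_closedCone hw (inv_nonneg.2 hn.le), by
      rw [mem_sphere_zero_iff_norm, norm_smul, norm_inv, norm_norm, inv_mul_cancel₀ hn.ne']⟩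
    rw [smul_dotProduct, smul_eq_mul, ← div_eq_inv_mul, le_div_iff₀ hn] at h1
    exact h1

lemma exists_sub_of_valueSemigroup [IsDomain R] [IsFractionRing R F] (u : Fin d → ℤ) :
    ∃ s ∈ ν.valueSemigroup R, ∃ t ∈ ν.valueSemigroup R, u = s - t := by
  obtain ⟨y, hy⟩ := ν.surjective (Multiplicative.ofAdd u)
  obtain ⟨x, z, hz, hxz⟩ := IsFractionRing.div_surjective (A := R) (y : F)
  have hz0 : algebraMap R F z ≠ 0 :=
    (map_ne_zero_iff _ (IsFractionRing.injective R F)).2 (nonZeroDivisors.ne_zero hz)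
  have hx : ((y * Units.mk0 _ hz0 : Fˣ) : F) = algebraMap R F x := by
    rw [Units.val_mul, ← hxz, Units.val_mk0, div_mul_cancel₀ _ hz0]
  refine ⟨_, ν.val_mem_valueSet (J := ⊤) trivial hx, _,
    ν.val_mem_valueSet (J := ⊤) (y := Units.mk0 _ hz0) trivial rfl, ?_⟩
  rw [val_mul, add_sub_cancel_right]
  simp [val, hy]

variable (hR : ∀ x : R, 0 ≤ ν.ord (algebraMap R F x))

lemma finite_levels (hfin : ∀ t, {u | u ∈ ν.valueSemigroup R ∧ latticeMap a u < t}.Finite) (t : ℝ) :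
    (levels R ν.ord t).Finite := by
  refine ((hfin t).image (latticeMap a)).subset ?_
  rintro r ⟨hrt, x, hx⟩
  obtain ⟨y, hy, rfl⟩ := ν.exists_unit_of_ord_eq hx
  exact ⟨_, ⟨ν.val_mem_valueSet (J := ⊤) trivial hy, hrt⟩, rfl⟩

lemma length_quotient_eq_sum
    (hfin : ∀ t, {u | u ∈ ν.valueSemigroup R ∧ latticeMap a u < t}.Finite) {J : Ideal R} {t : ℝ}
    (hJ : geIdeal ν.ord hR t ≤ J) :
    Module.length R (R ⧸ J) =
      ∑ u ∈ (hfin t).toFinset, gradedLength ν.ord hR J (latticeMap a u) := by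
  classical
  have h := length_quotient_sup_geIdeal (hR := hR) (ν.finite_levels hfin) J t
  rw [sup_eq_left.2 hJ] at h
  rw [h, ← Finset.sum_image (f := fun r => gradedLength ν.ord hR J r) (g := latticeMap a)
    ν.embedding.injOn]
  refine Finset.sum_congr ?_ fun _ _ => rfl
  ext r
  simp only [Set.Finite.mem_toFinset, Finset.mem_image]
  constructor
  · rintro ⟨hrt, x, hx⟩
    obtain ⟨y, hy, rfl⟩ := ν.exists_unit_of_ord_eq hx
    exact ⟨_, ⟨ν.val_mem_valueSet (J := ⊤) trivial hy, hrt⟩, rfl⟩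
  · rintro ⟨u, ⟨hu, hut⟩, rfl⟩
    obtain ⟨x, -, hx⟩ := hu
    exact ⟨hut, x, hx⟩

section Bounds

open IsLocalRing

variable [Algebra R ν.ring] (hA : ∀ x : R, ((algebraMap R ν.ring x : ν.ring) : F) = algebraMap R F x)
  (hfin : ∀ t, {u | u ∈ ν.valueSemigroup R ∧ latticeMap a u < t}.Finite)
  {b : R} {w : Fin d → ℤ} (hb : ν.ord (algebraMap R F b) = ((latticeMap a w : ℝ) : WithTop ℝ))
  (hbV : ∀ ξ : F, 0 ≤ ν.ord ξ → ∃ f : R, 0 < ν.ord (ξ - algebraMap R F f / algebraMap R F b))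
  {J : Ideal R} {t : ℝ} (hJ : geIdeal ν.ord hR t ≤ J)

include hA hfin hb hbV hJ

/-- The graded piece at u vanishes when u - w ∈ ν(J), and never exceeds the length of the residue
field. -/
lemma length_quotient_le : Module.length R (R ⧸ J) ≤
    ({u | (u ∈ ν.valueSemigroup R ∧ latticeMap a u < t) ∧ u - w ∉ ν.valueSet J}.ncard : ℕ∞) *
      Module.length R (ResidueField ν.ring) := by
  classical
  rw [ν.length_quotient_eq_sum hR hfin hJ]
  have hset : {u | (u ∈ ν.valueSemigroup R ∧ latticeMap a u < t) ∧ u - w ∉ ν.valueSet J} =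
      ((hfin t).toFinset.filter fun u => u - w ∉ ν.valueSet J : Finset (Fin d → ℤ)) := by
    ext u
    simp
  rw [hset, Set.ncard_coe_finset, ← nsmul_eq_mul, ← Finset.sum_const, Finset.sum_filter]
  refine Finset.sum_le_sum fun u hu => ?_
  rw [Set.Finite.mem_toFinset] at hu
  split_ifs with huJ
  · obtain ⟨s, hsJ, hs⟩ := huJ
    rw [map_sub] at hs
    exact (gradedLength_eq_zero_of_mem hb hbV hsJ hs).le
  · obtain ⟨x, -, hx⟩ := hu.1
    exact gradedLength_le (fun _ => ν.mem_ring_iff) hA hx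

lemma le_length_quotient :
    ({u | (u ∈ ν.valueSemigroup R ∧ latticeMap a u < t) ∧
      u - w ∈ ν.valueSemigroup R ∧ u ∉ ν.valueSet J}.ncard : ℕ∞) *
      Module.length R (ResidueField ν.ring) ≤ Module.length R (R ⧸ J) := by
  classical
  rw [ν.length_quotient_eq_sum hR hfin hJ]
  have hset : {u | (u ∈ ν.valueSemigroup R ∧ latticeMap a u < t) ∧
      u - w ∈ ν.valueSemigroup R ∧ u ∉ ν.valueSet J} = ((hfin t).toFinset.filter fun u =>
        u - w ∈ ν.valueSemigroup R ∧ u ∉ ν.valueSet J : Finset (Fin d → ℤ)) := by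
    ext u
    simp
  rw [hset, Set.ncard_coe_finset, ← nsmul_eq_mul, ← Finset.sum_const, Finset.sum_filter]
  refine Finset.sum_le_sum fun u hu => ?_
  split_ifs with huJ
  · obtain ⟨⟨s, -, hs⟩, huJ⟩ := huJ
    rw [map_sub] at hs
    exact le_gradedLength (fun _ => ν.mem_ring_iff) hA hb hbV hs
      fun j hj hju => huJ ⟨j, hj, hju⟩
  · exact zero_le

end Bounds

end LatticeValuation

open IsLocalRing

namespace LatticeValuation

variable {F : Type*} [Field F] {d : ℕ} {a : Fin d → ℝ} (ν : LatticeValuation F a)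
  {R : Type*} [CommRing R] [Algebra R F]

lemma valueSet_add_mem {J : Ideal R} {u s : Fin d → ℤ} (hu : u ∈ ν.valueSet J)
    (hs : s ∈ ν.valueSemigroup R) : u + s ∈ ν.valueSet J := by
  obtain ⟨x, hx, hxu⟩ := hu
  obtain ⟨y, -, hys⟩ := hs
  exact ⟨x * y, J.mul_mem_right y hx, by
    rw [map_mul, ν.ord.map_mul, hxu, hys, map_add, WithTop.coe_add]⟩

lemma valueSet_nsmul_mem {J K : Ideal R} {p : ℕ} (h : ∀ x ∈ J, x ^ p ∈ K) {u : Fin d → ℤ}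
    (hu : u ∈ ν.valueSet J) : p • u ∈ ν.valueSet K := by
  obtain ⟨x, hx, hxu⟩ := hu
  exact ⟨x ^ p, h x hx, by rw [map_pow, ν.ord.map_pow, hxu, map_nsmul, WithTop.coe_nsmul]⟩

lemma le_geIdeal_iff {hR : ∀ x : R, 0 ≤ ν.ord (algebraMap R F x)} {J : Ideal R} {t : ℝ} :
    J ≤ geIdeal ν.ord hR t ↔ ∀ u ∈ ν.valueSet J, t ≤ latticeMap a u := by
  constructor
  · rintro h u ⟨x, hx, hxu⟩
    have := mem_geIdeal.1 (h hx)
    rw [hxu] at this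
    exact WithTop.coe_le_coe.1 this
  · intro h x hx
    rw [mem_geIdeal]
    by_cases htop : ν.ord (algebraMap R F x) = ⊤
    · rw [htop]
      exact le_top
    · obtain ⟨r, hr⟩ := WithTop.ne_top_iff_exists.1 htop
      obtain ⟨y, hy, hyr⟩ := ν.exists_unit_of_ord_eq hr.symm
      rw [← hr, ← hyr]
      exact WithTop.coe_le_coe.2 (h _ (ν.val_mem_valueSet hx hy))

lemma frobeniusPow_le_geIdeal {hR : ∀ x : R, 0 ≤ ν.ord (algebraMap R F x)} {J : Ideal R} {t : ℝ}
    (hJ : J ≤ geIdeal ν.ord hR t) (q : ℕ) : frobeniusPow J q ≤ geIdeal ν.ord hR (t * q) := by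
  refine Ideal.span_le.2 ?_
  rintro _ ⟨x, hx, rfl⟩
  refine mem_geIdeal.2 ?_
  rw [map_pow, ν.ord.map_pow, mul_comm, ← nsmul_eq_mul, WithTop.coe_nsmul]
  exact nsmul_le_nsmul_right (mem_geIdeal.1 (hJ hx)) q

/-! ### Consequences of the OK conditions -/

namespace IsOK

variable {ν} [IsLocalRing R]

lemma ord_nonneg (h : ν.IsOK R) (x : R) : 0 ≤ ν.ord (algebraMap R F x) :=
  ν.mem_ring_iff.1 (h.le_ring x)

/-- Locality makes values on 𝔪 positive, and only finitely many values lie below 1. -/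
lemma exists_maximalIdeal_le_geIdeal (h : ν.IsOK R)
    (hfin : ∀ t, {u | u ∈ ν.valueSemigroup R ∧ latticeMap a u < t}.Finite) :
    ∃ t : ℝ, 0 < t ∧ maximalIdeal R ≤ geIdeal ν.ord h.ord_nonneg t := by
  have hpos : ∀ x ∈ maximalIdeal R, 0 < ν.ord (algebraMap R F x) := by
    intro x hx
    let z : ν.ring := ⟨algebraMap R F x, h.le_ring x⟩
    have hz : residue ν.ring z = 0 := by
      rw [residue_eq_zero_iff, mem_maximalIdeal, mem_nonunits_iff]
      intro hu
      exact hx (h.isLocalHom.map_nonunit x hu)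
    exact (residue_eq_zero_iff_pos (fun _ => ν.mem_ring_iff) z).1 hz
  have hA : (insert 1 (latticeMap a '' {u | (u ∈ ν.valueSemigroup R ∧ latticeMap a u < 1) ∧
      0 < latticeMap a u})).Finite := (((hfin 1).subset fun u hu => hu.1).image _).insert 1
  obtain ⟨t, ht, hmin⟩ := Set.exists_min_image _ id hA ⟨1, Set.mem_insert _ _⟩
  refine ⟨t, ?_, ?_⟩
  · rcases ht with rfl | ⟨u, hu, rfl⟩
    · exact one_pos
    · exact hu.2
  · rw [le_geIdeal_iff]
    rintro u ⟨x, hx, hxu⟩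
    rcases lt_or_ge (latticeMap a u) 1 with h1 | h1
    · refine hmin _ (Set.mem_insert_of_mem _ ⟨u, ⟨⟨⟨x, trivial, hxu⟩, h1⟩, ?_⟩, rfl⟩)
      have := hpos x hx
      rw [hxu] at this
      exact_mod_cast this
    · exact (hmin 1 (Set.mem_insert _ _)).trans h1

lemma exists_geIdeal_le_pow (h : ν.IsOK R) :
    ∃ c : ℝ, ∀ n : ℕ, geIdeal ν.ord h.ord_nonneg (n * c) ≤ maximalIdeal R ^ n := by
  obtain ⟨v, hv⟩ := h.exists_vector
  refine ⟨latticeMap a v, fun n x hx => hv n x (ν.mem_geq_iff.2 ?_)⟩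
  rw [map_nsmul, nsmul_eq_mul]
  exact mem_geIdeal.1 hx

lemma exists_isPSystem [IsNoetherianRing R] [IsDomain R] [IsFractionRing R F] (h : ν.IsOK R)
    {p : ℕ} (hp : p ≠ 0) {I : ℕ → Ideal R} (hI : IsPFamily p I)
    (hm : maximalIdeal R ≤ (I 0).radical) :
    ∃ κ M : ℝ, IsPSystem p a (ν.valueSemigroup R) κ M (fun e => ν.valueSet (I e)) ∧
      ∀ e, geIdeal ν.ord h.ord_nonneg (M * (p : ℝ) ^ e) ≤ I e := by
  obtain ⟨κ, hκ, hκp⟩ := ν.exists_mul_norm_le h.pointed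
  obtain ⟨N, hN⟩ := hI.exists_pow_le hp hm
  obtain ⟨c, hc⟩ := h.exists_geIdeal_le_pow
  have hle : ∀ e, geIdeal ν.ord h.ord_nonneg (N * c * (p : ℝ) ^ e) ≤ I e := fun e => by
    -- The truncation constant N c comes from R_{≥nc} ⊆ 𝔪^n with n = N p^e, followed by 𝔪^{N p^e} ⊆
    -- I_e.
    refine le_trans ?_ ((hc _).trans (hN e))
    rw [Nat.cast_mul, Nat.cast_pow, mul_right_comm]
  refine ⟨κ, N * c, ⟨ν.exists_sub_of_valueSemigroup, hκ,
    fun w hw => hκp w (ν.realCone_valueSemigroup_subset hw), fun e u hu => ν.valueSet_subset _ hu,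
    fun e u hu s hs => ν.valueSet_add_mem hu hs,
    fun e u hu => ν.valueSet_nsmul_mem (fun x hx => hI.pow_mem hx) hu, ?_⟩, hle⟩
  rintro e u ⟨x, -, hx⟩ hu
  refine ⟨x, hle e (mem_geIdeal.2 ?_), hx⟩
  rw [hx]
  exact_mod_cast hu

/-- The length of `R / J` is, up to a controlled error, a fixed multiple of the number of elements
of `ν(R) \ ν(J)`. -/
theorem exists_length_bounds [IsDomain R] [IsFractionRing R F] (h : ν.IsOK R)
    (hfin : ∀ t, {u | u ∈ ν.valueSemigroup R ∧ latticeMap a u < t}.Finite) :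
    ∃ δ : ℕ, 0 < δ ∧ ∃ w ∈ ν.valueSemigroup R, ∀ (J : Ideal R) (t : ℝ),
      geIdeal ν.ord h.ord_nonneg t ≤ J →
      |((Module.length R (R ⧸ J)).toNat : ℝ) -
        δ * ((ν.valueSemigroup R : Set (Fin d → ℤ)) \ ν.valueSet J).ncard| ≤
        δ * ({u | u ∈ ν.valueSemigroup R ∧ u - w ∉ ν.valueSemigroup R ∧
          latticeMap a u < t}.ncard : ℝ) := by
  let : Algebra R ν.ring := ((algebraMap R F).codRestrict ν.ring.toSubring h.le_ring).toAlgebra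
  have : IsLocalHom (algebraMap R ν.ring) := h.isLocalHom
  have hA : ∀ x : R, ((algebraMap R ν.ring x : ν.ring) : F) = algebraMap R F x := fun _ => rfl
  obtain ⟨hfinite, hlen⟩ := finite_residueField (R := R) (V := ν.ring) h.finite_residue
  obtain ⟨δ, hδ⟩ := ENat.ne_top_iff_exists.1 hlen
  obtain ⟨b, hb0, hbV⟩ := exists_lift_residue hfinite (fun _ => ν.mem_ring_iff) hA
  have hbF : algebraMap R F b ≠ 0 := (map_ne_zero_iff _ (IsFractionRing.injective R F)).2 hb0
  set w : Fin d → ℤ := ν.val (Units.mk0 _ hbF) with hw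
  have hb : ν.ord (algebraMap R F b) = ((latticeMap a w : ℝ) : WithTop ℝ) :=
    ν.ord_unit (Units.mk0 _ hbF)
  have hδ0 : 0 < δ := by
    have : (0 : ℕ∞) < Module.length R (ResidueField ν.ring) := Module.length_pos
    rw [← hδ] at this
    exact_mod_cast this
  refine ⟨δ, hδ0, w, ⟨b, trivial, hb⟩, fun J t hJ => ?_⟩
  have hup := ν.length_quotient_le h.ord_nonneg hA hfin hb hbV hJ
  have hlow := ν.le_length_quotient h.ord_nonneg hA hfin hb hbV hJ
  rw [← hδ] at hup hlow
  obtain ⟨l, hl⟩ := ENat.ne_top_iff_exists.1 (ne_top_of_le_ne_top (by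
    exact_mod_cast ENat.natCast_ne_top _) hup)
  rw [← hl] at hup hlow ⊢
  rw [ENat.toNat_natCast]
  set S : Set (Fin d → ℤ) := (ν.valueSemigroup R : Set (Fin d → ℤ)) with hS
  set E : Set (Fin d → ℤ) := {u | u ∈ ν.valueSemigroup R ∧ u - w ∉ ν.valueSemigroup R ∧
          latticeMap a u < t} with hE
  have hlt : ∀ u ∈ S \ ν.valueSet J, latticeMap a u < t := by
    rintro u ⟨⟨x, -, hx⟩, hu⟩
    by_contra! hcon
    refine hu ⟨x, hJ (mem_geIdeal.2 ?_), hx⟩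
    rw [hx]
    exact_mod_cast hcon
  have hEfin : E.Finite := (hfin t).subset fun u hu => ⟨hu.1, hu.2.2⟩
  have hdfin : (S \ ν.valueSet J).Finite := (hfin t).subset fun u hu => ⟨hu.1, hlt u hu⟩
  -- Either u - w lies in S \ ν(J), counted after translation by w, or u - w leaves S and u is in
  -- the error set E.
  have h1 : {u | (u ∈ ν.valueSemigroup R ∧ latticeMap a u < t) ∧ u - w ∉ ν.valueSet J}.ncard ≤
      (S \ ν.valueSet J).ncard + E.ncard := by
    rw [← Set.ncard_image_of_injective (S \ ν.valueSet J) (add_left_injective w)]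
    refine (Set.ncard_le_ncard ?_ ((hdfin.image _).union hEfin)).trans (Set.ncard_union_le _ _)
    rintro u ⟨⟨hu, hut⟩, huJ⟩
    by_cases huw : u - w ∈ ν.valueSemigroup R
    · exact Or.inl ⟨u - w, ⟨huw, huJ⟩, sub_add_cancel u w⟩
    · exact Or.inr ⟨hu, huw, hut⟩
  have h2 : (S \ ν.valueSet J).ncard ≤ {u | (u ∈ ν.valueSemigroup R ∧ latticeMap a u < t) ∧
      u - w ∈ ν.valueSemigroup R ∧ u ∉ ν.valueSet J}.ncard + E.ncard := by
    refine (Set.ncard_le_ncard ?_ (((hfin t).subset fun u hu => hu.1).union hEfin)).trans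
      (Set.ncard_union_le _ _)
    intro u hu
    by_cases huw : u - w ∈ ν.valueSemigroup R
    · exact Or.inl ⟨⟨hu.1, hlt u hu⟩, huw, hu.2⟩
    · exact Or.inr ⟨hu.1, huw, hlt u hu⟩
  norm_cast at hup hlow
  have hup' : (l : ℝ) ≤ ((S \ ν.valueSet J).ncard + E.ncard) * δ := by
    exact_mod_cast hup.trans (Nat.mul_le_mul_right δ h1)
  have hlow' : ((S \ ν.valueSet J).ncard : ℝ) * δ ≤ l + E.ncard * δ := by
    have := Nat.mul_le_mul_right δ h2
    rw [add_mul] at this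
    exact_mod_cast this.trans (Nat.add_le_add_right hlow _)
  rw [abs_le]
  constructor <;> linarith

end IsOK

end LatticeValuation

end OKDomain

end

/-! ### The volume and its positivity -/

theorem mainTheorem6 {R : Type*} [CommRing R] [IsDomain R] [IsLocalRing R] [IsNoetherianRing R]
    (p : ℕ) [Fact p.Prime] [CharP R p] (hR : OKDomain.IsOKDomain R)
    (d : ℕ) (hd : ringKrullDim R = d)
    (I : ℕ → Ideal R) (hI : OKDomain.IsPFamily p I) (hm : ∀ e, OKDomain.IsMaxPrimary (I e)) :
    ∃ vol : ℝ, OKDomain.HasVolume p d I vol ∧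
      (0 < vol ↔ ∃ e₀ : ℕ, ∀ e : ℕ,
        I (e + e₀) ≤ OKDomain.frobeniusPow (IsLocalRing.maximalIdeal R) (p ^ e)) := by
  obtain ⟨d', hd', a, ν, hν⟩ := hR
  obtain rfl : d' = d := by
    rw [hd'] at hd
    exact_mod_cast hd
  have hp : 1 < p := (Fact.out : p.Prime).one_lt
  have hp1 : (1 : ℝ) < p := by exact_mod_cast hp
  have hn : Tendsto (fun e : ℕ => (p : ℝ) ^ e) atTop atTop := tendsto_pow_atTop_atTop_of_one_lt hp1
  obtain ⟨κ, M, hsys, hM⟩ := hν.exists_isPSystem (by omega : p ≠ 0) hI (hm 0).2.ge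
  obtain ⟨L, hL⟩ := hsys.exists_tendsto hp
  obtain ⟨δ, hδ, w, hw, hbound⟩ := hν.exists_length_bounds hsys.finite_lt
  have hδ' : (0 : ℝ) < δ := by exact_mod_cast hδ
  have hgap := OKDomain.tendsto_ncard_gap hsys.exists_sub hsys.pos hsys.pointed M
    (ρ := fun _ => ‖OKDomain.realVec w‖) hn (fun e => by positivity)
    (tendsto_const_nhds.div_atTop hn)
  refine ⟨δ * L, ?_, ?_⟩
  · have h0 := hgap.const_mul (δ : ℝ)
    rw [mul_zero] at h0
    have h1 : Tendsto (fun e : ℕ => ((Module.length R (R ⧸ I e)).toNat : ℝ) / ((p : ℝ) ^ e) ^ d' -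
        δ * ((((ν.valueSemigroup R : Set (Fin d' → ℤ)) \ ν.valueSet (I e)).ncard : ℝ) /
          ((p : ℝ) ^ e) ^ d')) atTop (𝓝 0) := by
      refine squeeze_zero_norm (fun e => ?_) h0
      have hq : (0 : ℝ) < ((p : ℝ) ^ e) ^ d' := by positivity
      rw [← mul_div_assoc, ← sub_div, ← mul_div_assoc, norm_div, Real.norm_of_nonneg hq.le]
      refine div_le_div_of_nonneg_right ((hbound _ _ (hM e)).trans ?_) hq.le
      refine mul_le_mul_of_nonneg_left ?_ hδ'.le
      exact_mod_cast hsys.ncard_shift_le hw _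
    have h2 := h1.add (hL.const_mul (δ : ℝ))
    simp only [sub_add_cancel, zero_add] at h2
    exact h2
  · rw [mul_pos_iff_of_pos_left hδ']
    constructor
    · intro hL0
      obtain ⟨ε, hε, hεT⟩ := hsys.exists_le_of_pos hp hL hL0
      obtain ⟨N, hN⟩ := OKDomain.exists_pow_mul_le_frobeniusPow
        (IsNoetherian.noetherian (IsLocalRing.maximalIdeal R))
      obtain ⟨c, hc⟩ := hν.exists_geIdeal_le_pow
      -- With ε p^{e₀} ≥ N c, heights in I_{e+e₀} are at least N c p^e, hence I_{e+e₀} ⊆ 𝔪^{N p^e} ⊆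
      -- 𝔪^{[p^e]}.
      obtain ⟨e₀, he₀⟩ := (hn.eventually (eventually_ge_atTop (N * c / ε))).exists
      refine ⟨e₀, fun e => le_trans ?_ ((hc _).trans (hN (p ^ e) (by positivity)))⟩
      rw [ν.le_geIdeal_iff]
      intro u hu
      refine le_trans ?_ (hεT _ u hu)
      rw [div_le_iff₀ hε] at he₀
      push_cast
      rw [pow_add]
      have := mul_le_mul_of_nonneg_left he₀ (by positivity : (0 : ℝ) ≤ (p : ℝ) ^ e)
      linarith
    · rintro ⟨e₀, he₀⟩
      obtain ⟨t, ht, htm⟩ := hν.exists_maximalIdeal_le_geIdeal hsys.finite_lt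
      -- Values on 𝔪^{[p^k]} are at least t p^k = (t / p^{e₀}) p^{k+e₀}.
      refine hsys.pos_of_eventually_le (by omega) hL (ε := t / (p : ℝ) ^ e₀) (by positivity) ?_
      filter_upwards [eventually_ge_atTop e₀] with e he u hu
      obtain ⟨k, rfl⟩ := Nat.exists_eq_add_of_le' he
      have h1 := ν.le_geIdeal_iff.1 ((he₀ k).trans (ν.frobeniusPow_le_geIdeal htm (p ^ k))) u hu
      refine le_trans (le_of_eq ?_) h1
      have hpe : (p : ℝ) ^ e₀ ≠ 0 := by positivity
      push_cast
      rw [pow_add]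
      field_simp
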